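/- Let $\mathbf{Poly}$ be the category of polynomials $p=\sum_{I\in p(1)}y^{p[I]}$ (a set $p(1)$ of positions and, for each position $I$, a set $p[I]$ of directions; a morphism is a function on positions together with functions backwards on directions), with its composition monoidal structure $(\triangleleft,y)$. Comonoids in $\mathbf{Poly}$ are small categories: positions are objects and directions at $C$ are morphisms out of $C$; comonoid homomorphisms are cofunctors. Let $\mathbf{Cat}^\sharp$ be the bicategory whose objects are these comonoids, whose 1-cells $c\to d$ are the $(c,d)$-bicomodules, with composition $p\triangleleft_d q$ the equalizer of $p\triangleleft q\rightrightarrows p\triangleleft d\triangleleft q$, and whose 2-cells are bicomodule morphisms. Write $0$ for the empty category; the $(c,0)$-bicomodules are the copresheaves on $c$. For a $(d,c)$-bicomodule $p$ and $D\in d(1)$, let $p_D(1)$ be the set of positions of $p$ sent to $D$ by the left coaction $p\to d\triangleleft p$, and for $I\in p(1)$ regard $p[I]$ as a copresheaf on $c$ by means of the right coaction $p\to p\triangleleft c$. Let $m$ be a monad on $c$ in $\mathbf{Cat}^\sharp$ (with induced monad $m\triangleleft_c-$ on copresheaves on $c$, whose Kleisli category is called the Kleisli category of $m$), and let $p$ be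 any $(d,c)$-bicomodule. **Theorem.** The coclosure $\left[\begin{smallmatrix}p\\p\triangleleft_c m\end{smallmatrix}\right]$ exists, that is, a $(d,d)$-bicomodule $L$ with a universal (initial) bicomodule morphism $\eta\colon p\to L\triangleleft_d(p\triangleleft_c m)$. For every such $(L,\eta)$, equip $L$ with its comonad structure, whose counit $L\to d$ corresponds under the universal property to $p\to p\triangleleft_c m\cong d\triangleleft_d(p\triangleleft_c m)$ (unit of $m$), and whose comultiplication corresponds to $p\xrightarrow{\eta}L\triangleleft_d p\triangleleft_c m\xrightarrow{L\triangleleft\eta\triangleleft m}L\triangleleft_d L\triangleleft_d p\triangleleft_c m\triangleleft_c m\to L\triangleleft_d L\triangleleft_d p\triangleleft_c m$ (multiplication of $m$). The carrier of $L$ is then a comonoid in $\mathbf{Poly}$, with counit $L\to d\to y$ and comultiplication $L\to L\triangleleft_d L\to L\triangleleft L$, and the counit $L\to d$ of the comonad is a cofunctor. This carrier comonoid is isomorphic, as a comonoid in $\mathbf{Poly}$, to (the comonoid corresponding to) the opposite of the full subcategory of the Kleisli category of $m$ spanned by the copresheaves $p[I]$ for $I\in p(1)$, with set of objects indexed by $p(1)$.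 The isomorphism may be chosen so that, for every $I\in p(1)$, it takes the position of $L$ which is the $L$-component of $\eta(I)$ to the object $p[I]$, and so that the resulting cofunctor from this category to $d$ sends the object $p[I]$, for $I\in p_D(1)$, to $D\in d(1)$. -/

import Mathlib

universe u

/-! ## Polynomials -/

namespace PFunctor

open CategoryTheory MonoidalCategory Limits

/-- A morphism of polynomials `p ⟶ q`: a function on positions and, contravariantly, functions
on directions. -/
structure Lens (p q : PFunctor.{u, u}) where
  onPos : p.A → q.A
  onDir : ∀ I : p.A, q.B (onPos I) → p.B I

namespace Lens

variable {p q : PFunctor.{u, u}}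

/-- The component of a lens at a position of its source, as an element of the polynomial functor
`q` evaluated at the set of directions. -/
def atPos (f : Lens p q) (I : p.A) : q.Obj (p.B I) := ⟨f.onPos I, f.onDir I⟩

theorem ext_atPos {f g : Lens p q} (h : ∀ I, f.atPos I = g.atPos I) : f = g := by
  obtain ⟨f₁, f₂⟩ := f
  obtain ⟨g₁, g₂⟩ := g
  have h₁ : f₁ = g₁ := funext fun I => congrArg Sigma.fst (h I)
  subst h₁
  have h₂ : f₂ = g₂ := funext fun I => eq_of_heq (Sigma.mk.inj (h I)).2
  subst h₂
  rfl

end Lens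

/-- The category of polynomials. -/
instance lensCategory : Category PFunctor.{u, u} where
  Hom := Lens
  id p := ⟨fun I => I, fun _ i => i⟩
  comp f g := ⟨fun I => g.onPos (f.onPos I), fun I i => f.onDir I (g.onDir (f.onPos I) i)⟩

/-- The composition monoidal structure on polynomials, with unit the polynomial with a single
position and a single direction. -/
instance compositionMonoidal : MonoidalCategory PFunctor.{u, u} where
  tensorObj p q := p.comp q
  tensorUnit := ⟨PUnit, fun _ => PUnit⟩
  whiskerLeft p _ _ f := ⟨fun x => ⟨x.1, fun i => f.onPos (x.2 i)⟩,
    fun x z => ⟨z.1, f.onDir (x.2 z.1) z.2⟩⟩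
  whiskerRight f q := ⟨fun x => ⟨f.onPos x.1, fun i => x.2 (f.onDir x.1 i)⟩,
    fun x z => ⟨f.onDir x.1 z.1, z.2⟩⟩
  tensorHom f g := ⟨fun x => ⟨f.onPos x.1, fun i => g.onPos (x.2 (f.onDir x.1 i))⟩,
    fun x z => ⟨f.onDir x.1 z.1, g.onDir _ z.2⟩⟩
  associator p q r :=
    { hom := ⟨fun x => ⟨x.1.1, fun i => ⟨x.1.2 i, fun j => x.2 ⟨i, j⟩⟩⟩,
        fun _ z => ⟨⟨z.1, z.2.1⟩, z.2.2⟩⟩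
      inv := ⟨fun x => ⟨⟨x.1, fun i => (x.2 i).1⟩, fun z => (x.2 z.1).2 z.2⟩,
        fun _ z => ⟨z.1.1, z.1.2, z.2⟩⟩ }
  leftUnitor p :=
    { hom := ⟨fun x => x.2 PUnit.unit, fun _ i => ⟨PUnit.unit, i⟩⟩
      inv := ⟨fun I => ⟨PUnit.unit, fun _ => I⟩, fun _ z => z.2⟩ }
  rightUnitor p :=
    { hom := ⟨fun x => x.1, fun _ i => ⟨i, PUnit.unit⟩⟩
      inv := ⟨fun I => ⟨I, fun _ => PUnit.unit⟩, fun _ z => z.1⟩ }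

/-! ### Equalizers of polynomials, and their preservation by composition -/

theorem Lens.atPos_congr {p q : PFunctor.{u, u}} {f g : p ⟶ q} (h : f = g) (I : p.A) :
    Lens.atPos f I = Lens.atPos g I := by rw [h]

section Equalizers

variable {p q : PFunctor.{u, u}} (f g : p ⟶ q)

/-- Two directions of `p` are identified in the equalizer of `f` and `g` if they are the images
under `f` and `g` of a common direction of `q`. -/
def EqRel (I : p.A) (i i' : p.B I) : Prop :=
  ∃ (j : q.B (f.onPos I)) (j' : q.B (g.onPos I)), HEq j j' ∧ i = f.onDir I j ∧ i' = g.onDir I j'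

/-- The equalizer of two morphisms of polynomials. -/
def eqObj : PFunctor.{u, u} :=
  ⟨{I : p.A // f.onPos I = g.onPos I}, fun I => Quot (EqRel f g I.1)⟩

/-- The inclusion of the equalizer. -/
def eqι : eqObj f g ⟶ p := Lens.mk (fun I => I.1) (fun _ i => Quot.mk _ i)

theorem eqι_condition : eqι f g ≫ f = eqι f g ≫ g := by
  refine Lens.ext_atPos fun I => ?_
  refine Sigma.ext I.2 (Function.hfunext (congrArg q.B I.2) fun a b hab => ?_)
  exact heq_of_eq (Quot.sound ⟨a, b, hab, rfl, rfl⟩)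

variable {f g}

theorem Lens.onDir_congr {f g : p ⟶ q} (h : f = g) (I : p.A) {j : q.B (f.onPos I)}
    {j' : q.B (g.onPos I)} (hj : HEq j j') : f.onDir I j = g.onDir I j' := by
  subst h
  rw [eq_of_heq hj]

/-- The morphism into the equalizer induced by an equalizing morphism. -/
def eqLift {r : PFunctor.{u, u}} (k : r ⟶ p) (h : k ≫ f = k ≫ g) : r ⟶ eqObj f g :=
  Lens.mk (fun x => ⟨k.onPos x, congrArg Sigma.fst (Lens.atPos_congr h x)⟩)
    (fun x => Quot.lift (k.onDir x) (by
      rintro _ _ ⟨j, j', hj, rfl, rfl⟩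
      exact Lens.onDir_congr h x (j := j) (j' := j') hj))

/-- A lens that is injective on positions and surjective on directions is a monomorphism. -/
theorem Lens.cancel {p q r : PFunctor.{u, u}} {m m' : r ⟶ p} (k : p ⟶ q)
    (hk : Function.Injective (Lens.onPos k)) (hk' : ∀ I, Function.Surjective (Lens.onDir k I))
    (h : m ≫ k = m' ≫ k) : m = m' := by
  obtain ⟨m₁, m₂⟩ := m
  obtain ⟨m₁', m₂'⟩ := m'
  have h₁ : m₁ = m₁' := funext fun x => hk (congrArg Sigma.fst (Lens.atPos_congr h x))
  subst h₁
  have h₂ : m₂ = m₂' := by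
    funext x i
    obtain ⟨j, rfl⟩ := hk' _ i
    exact Lens.onDir_congr h x (j := j) (j' := j) HEq.rfl
  subst h₂
  rfl

variable (f g)

/-- The universal property of the equalizer. -/
def eqIsLimit : IsLimit (Fork.ofι (eqι f g) (eqι_condition f g)) :=
  Fork.IsLimit.mk' _ fun s => ⟨eqLift s.ι s.condition, rfl, fun hm =>
    Lens.cancel (eqι f g) (fun _ _ h => Subtype.ext h) (fun _ => Quot.mk_surjective)
      (hm.trans rfl)⟩

instance hasEqualizersPoly : HasEqualizers PFunctor.{u, u} :=
  have : ∀ {p q : PFunctor.{u, u}} {f g : p ⟶ q}, HasLimit (parallelPair f g) :=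
    fun {_ _ f g} => ⟨⟨⟨_, eqIsLimit f g⟩⟩⟩
  hasEqualizers_of_hasLimit_parallelPair _

end Equalizers

/-! ### Composition of polynomials preserves equalizers in each variable -/

section Preserves

variable (a p q r : PFunctor.{u, u})

/-- The right coclosure of `p` by `q`, the value at `p` of the left adjoint of `- ◁ q`. -/
def coclosure : PFunctor.{u, u} := ⟨p.A, fun I => q.Obj (p.B I)⟩

variable {p r} in
/-- The adjunction bijection for the right coclosure of polynomials. -/
def coclosureEquiv : (coclosure p q ⟶ r) ≃ (p ⟶ r ⊗ q) where
  toFun f := Lens.mk (fun I => ⟨Lens.onPos f I, fun k => (Lens.onDir f I k).1⟩)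
    (fun I z => (Lens.onDir f I z.1).2 z.2)
  invFun f := Lens.mk (fun I => (Lens.onPos f I).1)
    (fun I k => ⟨(Lens.onPos f I).2 k, fun z => Lens.onDir f I ⟨k, z⟩⟩)

instance isRightAdjoint_tensorRight (q : PFunctor.{u, u}) :
    (tensorRight q).IsRightAdjoint :=
  ⟨_, ⟨Adjunction.adjunctionOfEquivLeft (G := tensorRight q) (F_obj := fun p => coclosure p q)
    (fun _ _ => coclosureEquiv q) (fun _ _ _ _ _ => rfl)⟩⟩

instance preserves_tensorRight (q : PFunctor.{u, u}) :
    PreservesLimitsOfShape WalkingParallelPair (tensorRight q) :=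
  inferInstance

/-- The representable polynomial with set of directions `S`. -/
def rep (S : Type u) : PFunctor.{u, u} := ⟨PUnit, fun _ => S⟩

variable {r} in
/-- A morphism into a composite `a ◁ p`, pointwise on positions and directions of `a`. -/
def compEquiv : (r ⟶ a ⊗ p) ≃ ∀ x : r.A, Σ I : a.A, a.B I → (rep (r.B x) ⟶ p) where
  toFun f x := ⟨(Lens.onPos f x).1, fun i =>
    Lens.mk (fun _ => (Lens.onPos f x).2 i) (fun _ j => Lens.onDir f x ⟨i, j⟩)⟩
  invFun f := Lens.mk (fun x => ⟨(f x).1, fun i => Lens.onPos ((f x).2 i) PUnit.unit⟩)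
    (fun x z => Lens.onDir ((f x).2 z.1) PUnit.unit z.2)

theorem compEquiv_naturality {p q : PFunctor.{u, u}} (k : r ⟶ a ⊗ p) (f : p ⟶ q) (x : r.A) :
    compEquiv a q (k ≫ a ◁ f) x = ⟨(compEquiv a p k x).1, fun i => (compEquiv a p k x).2 i ≫ f⟩ :=
  rfl

variable {r} in
theorem comp_condition {p q : PFunctor.{u, u}} {f g : p ⟶ q} {k : r ⟶ a ⊗ p}
    (h : k ≫ a ◁ f = k ≫ a ◁ g) (x : r.A) (i : a.B (compEquiv a p k x).1) :
    (compEquiv a p k x).2 i ≫ f = (compEquiv a p k x).2 i ≫ g := by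
  have h₁ := congrFun (congrArg (compEquiv a q) h) x
  rw [compEquiv_naturality, compEquiv_naturality] at h₁
  exact congrFun (eq_of_heq (Sigma.mk.inj h₁).2) i

theorem whiskerLeft_eqι_cancel {p q r : PFunctor.{u, u}} (f g : p ⟶ q)
    {m m' : r ⟶ a ⊗ eqObj f g} (h : m ≫ a ◁ eqι f g = m' ≫ a ◁ eqι f g) : m = m' := by
  refine Lens.cancel (a ◁ eqι f g) ?_ ?_ h
  · rintro ⟨I, J⟩ ⟨I', J'⟩ h
    obtain rfl : I = I' := congrArg Sigma.fst h
    have h₂ := eq_of_heq (Sigma.mk.inj h).2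
    exact Sigma.ext rfl (heq_of_eq (funext fun i => Subtype.ext (congrFun h₂ i)))
  · rintro ⟨I, J⟩ ⟨i, ⟨j⟩⟩
    exact ⟨⟨i, j⟩, rfl⟩

instance preserves_tensorLeft : PreservesLimitsOfShape WalkingParallelPair (tensorLeft a) := by
  have key : ∀ {p q : PFunctor.{u, u}} (f g : p ⟶ q),
      PreservesLimit (parallelPair f g) (tensorLeft a) := fun f g =>
    preservesLimit_of_preserves_limit_cone (eqIsLimit f g)
      ((isLimitMapConeForkEquiv (tensorLeft a) (eqι_condition f g)).symm
        (Fork.IsLimit.mk' _ fun s =>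
          ⟨(compEquiv a _).symm fun x => ⟨(compEquiv a _ s.ι x).1, fun i =>
              eqLift ((compEquiv a _ s.ι x).2 i) (comp_condition a s.condition x i)⟩,
            rfl, fun hm => whiskerLeft_eqι_cancel a f g (hm.trans rfl)⟩))
  exact ⟨fun {K} => preservesLimit_of_iso_diagram _ (diagramIsoParallelPair K).symm⟩

end Preserves

end PFunctor

/-! ## Comonoids and bicomodules -/

section Bicomodules

open CategoryTheory MonoidalCategory Limits ComonObj

universe v w

variable {V : Type w} [Category.{v} V] [MonoidalCategory V]

/-- A `(c, d)`-bicomodule for comonoids `c` and `d` in a monoidal category. -/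
structure Bicomod (c d : Comon V) where
  /-- The carrier. -/
  X : V
  /-- The left coaction. -/
  coactLeft : X ⟶ c.X ⊗ X
  /-- The right coaction. -/
  coactRight : X ⟶ X ⊗ d.X
  left_counit : coactLeft ≫ ε[c.X] ▷ X = (λ_ X).inv
  left_comul : coactLeft ≫ Δ[c.X] ▷ X = coactLeft ≫ c.X ◁ coactLeft ≫ (α_ _ _ _).inv
  right_counit : coactRight ≫ X ◁ ε[d.X] = (ρ_ X).inv
  right_comul : coactRight ≫ X ◁ Δ[d.X] = coactRight ≫ coactRight ▷ d.X ≫ (α_ _ _ _).hom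
  middle : coactRight ≫ coactLeft ▷ d.X = coactLeft ≫ c.X ◁ coactRight ≫ (α_ _ _ _).inv

namespace Bicomod

attribute [simp] left_counit left_comul right_counit right_comul

variable {b c d e : Comon V}

theorem middle_whiskerRight (p : Bicomod c d) (Z : V) :
    p.coactLeft ▷ Z ≫ (c.X ◁ p.coactRight) ▷ Z =
      p.coactRight ▷ Z ≫ p.coactLeft ▷ d.X ▷ Z ≫ (α_ _ _ _).hom ▷ Z := by
  simp only [← comp_whiskerRight]
  rw [← Category.assoc, p.middle]
  simp

theorem middle_whiskerLeft (p : Bicomod c d) (Z : V) :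
    Z ◁ p.coactRight ≫ Z ◁ p.coactLeft ▷ d.X =
      Z ◁ p.coactLeft ≫ Z ◁ c.X ◁ p.coactRight ≫ Z ◁ (α_ _ _ _).inv := by
  simp only [← whiskerLeft_comp]
  rw [p.middle]

/-- A morphism of bicomodules: a morphism of carriers commuting with both coactions. -/
@[ext]
structure Hom (p q : Bicomod c d) where
  /-- The morphism of carriers. -/
  hom : p.X ⟶ q.X
  left : p.coactLeft ≫ c.X ◁ hom = hom ≫ q.coactLeft
  right : p.coactRight ≫ hom ▷ d.X = hom ≫ q.coactRight


instance category : Category (Bicomod c d) where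
  Hom := Hom
  id p := ⟨𝟙 p.X, by simp, by simp⟩
  comp f g := ⟨f.hom ≫ g.hom, by rw [whiskerLeft_comp, reassoc_of% f.left, g.left, Category.assoc],
    by rw [comp_whiskerRight, reassoc_of% f.right, g.right, Category.assoc]⟩

@[ext]
theorem hom_ext {p q : Bicomod c d} {f g : p ⟶ q} (h : f.hom = g.hom) : f = g := Hom.ext h

@[simp] theorem id_hom (p : Bicomod c d) : Hom.hom (𝟙 p) = 𝟙 p.X := rfl

@[simp] theorem comp_hom {p q r : Bicomod c d} (f : p ⟶ q) (g : q ⟶ r) :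
    (f ≫ g).hom = f.hom ≫ g.hom := rfl

/-- An isomorphism of bicomodules from an isomorphism of carriers. -/
@[simps]
def isoMk {p q : Bicomod c d} (f : p ⟶ q) (g : q.X ⟶ p.X) (h₁ : f.hom ≫ g = 𝟙 _)
    (h₂ : g ≫ f.hom = 𝟙 _) : p ≅ q where
  hom := f
  inv :=
    { hom := g
      left := by
        have : q.coactLeft = g ≫ p.coactLeft ≫ c.X ◁ f.hom := by
          rw [f.left, reassoc_of% h₂]
        rw [this, Category.assoc, Category.assoc, ← whiskerLeft_comp, h₁]
        simp
      right := by
        have : q.coactRight = g ≫ p.coactRight ≫ f.hom ▷ d.X := by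
          rw [f.right, reassoc_of% h₂]
        rw [this, Category.assoc, Category.assoc, ← comp_whiskerRight, h₁]
        simp }
  hom_inv_id := hom_ext h₁
  inv_hom_id := hom_ext h₂

/-- The identity bicomodule on a comonoid, given by its comultiplication. -/
@[simps]
abbrev regular (c : Comon V) : Bicomod c c where
  X := c.X
  coactLeft := Δ
  coactRight := Δ
  left_counit := by simp
  left_comul := by simp
  right_counit := by simp
  right_comul := by simp
  middle := by simp

variable [HasEqualizers V]

/-- The carrier of the composite of two bicomodules, as the equalizer of the two maps
`p ⊗ q ⟶ p ⊗ (d ⊗ q)` induced by the right coaction of `p` and the left coaction of `q`. -/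
noncomputable def compX (p : Bicomod c d) (q : Bicomod d e) : V :=
  equalizer (p.coactRight ▷ q.X ≫ (α_ _ _ _).hom) (p.X ◁ q.coactLeft)

/-- The inclusion of the composite of bicomodules into the tensor product of the carriers. -/
noncomputable def ι (p : Bicomod c d) (q : Bicomod d e) : compX p q ⟶ p.X ⊗ q.X :=
  equalizer.ι _ _

instance mono_ι (p : Bicomod c d) (q : Bicomod d e) : Mono (ι p q) :=
  inferInstanceAs (Mono (equalizer.ι _ _))

theorem ι_condition (p : Bicomod c d) (q : Bicomod d e) :
    ι p q ≫ p.coactRight ▷ q.X = ι p q ≫ p.X ◁ q.coactLeft ≫ (α_ _ _ _).inv := by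
  have : ι p q ≫ p.coactRight ▷ q.X ≫ (α_ _ _ _).hom = ι p q ≫ p.X ◁ q.coactLeft :=
    equalizer.condition _ _
  rw [← reassoc_of% this]
  simp

/-- The morphism into a composite of bicomodules induced by an equalizing morphism. -/
noncomputable def lift (p : Bicomod c d) (q : Bicomod d e) {W : V} (k : W ⟶ p.X ⊗ q.X)
    (h : k ≫ p.coactRight ▷ q.X = k ≫ p.X ◁ q.coactLeft ≫ (α_ _ _ _).inv) : W ⟶ compX p q :=
  equalizer.lift k (by rw [reassoc_of% h]; simp)

@[simp]
theorem lift_ι (p : Bicomod c d) (q : Bicomod d e) {W : V} (k : W ⟶ p.X ⊗ q.X)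
    (h : k ≫ p.coactRight ▷ q.X = k ≫ p.X ◁ q.coactLeft ≫ (α_ _ _ _).inv) :
    lift p q k h ≫ ι p q = k :=
  equalizer.lift_ι _ _

theorem mono_map_ι (F : V ⥤ V) [PreservesLimitsOfShape WalkingParallelPair F]
    (p : Bicomod c d) (q : Bicomod d e) : Mono (F.map (ι p q)) :=
  mono_of_isLimit_fork (isLimitForkMapOfIsLimit F _ (equalizerIsEqualizer
    (p.coactRight ▷ q.X ≫ (α_ _ _ _).hom) (p.X ◁ q.coactLeft)))

section Left

variable [∀ X : V, PreservesLimitsOfShape WalkingParallelPair (tensorLeft X)]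

instance mono_whiskerLeft_ι (Z : V) (p : Bicomod c d) (q : Bicomod d e) : Mono (Z ◁ ι p q) :=
  mono_map_ι (tensorLeft Z) p q

instance mono_whiskerLeft_ι₂ (Y Z : V) (p : Bicomod c d) (q : Bicomod d e) :
    Mono (Y ◁ Z ◁ ι p q) :=
  mono_map_ι (tensorLeft Z ⋙ tensorLeft Y) p q

/-- The morphism into `Z ⊗ compX p q` induced by an equalizing morphism. -/
noncomputable def liftLeft (Z : V) (p : Bicomod c d) (q : Bicomod d e) {W : V}
    (k : W ⟶ Z ⊗ (p.X ⊗ q.X))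
    (h : k ≫ Z ◁ p.coactRight ▷ q.X =
      k ≫ Z ◁ p.X ◁ q.coactLeft ≫ Z ◁ (α_ _ _ _).inv) : W ⟶ Z ⊗ compX p q :=
  Fork.IsLimit.lift (isLimitForkMapOfIsLimit (tensorLeft Z) _ (equalizerIsEqualizer
    (p.coactRight ▷ q.X ≫ (α_ _ _ _).hom) (p.X ◁ q.coactLeft))) k (by
      simp only [curriedTensor_obj_map, whiskerLeft_comp]
      rw [reassoc_of% h, ← whiskerLeft_comp, Iso.inv_hom_id]
      simp)

@[simp]
theorem liftLeft_ι (Z : V) (p : Bicomod c d) (q : Bicomod d e) {W : V}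
    (k : W ⟶ Z ⊗ (p.X ⊗ q.X))
    (h : k ≫ Z ◁ p.coactRight ▷ q.X =
      k ≫ Z ◁ p.X ◁ q.coactLeft ≫ Z ◁ (α_ _ _ _).inv) :
    liftLeft Z p q k h ≫ Z ◁ ι p q = k :=
  Fork.IsLimit.lift_ι (isLimitForkMapOfIsLimit (tensorLeft Z) _ (equalizerIsEqualizer
    (p.coactRight ▷ q.X ≫ (α_ _ _ _).hom) (p.X ◁ q.coactLeft)))

/-- The left coaction on a composite of bicomodules. -/
noncomputable def compLeft (p : Bicomod c d) (q : Bicomod d e) :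
    compX p q ⟶ c.X ⊗ compX p q :=
  liftLeft c.X p q (ι p q ≫ p.coactLeft ▷ q.X ≫ (α_ _ _ _).hom) (by
    simp only [Category.assoc]
    rw [← associator_naturality_middle, reassoc_of% (p.middle_whiskerRight q.X),
      reassoc_of% (ι_condition p q)]
    rw [← associator_naturality_right_assoc, ← whisker_exchange_assoc,
      ← associator_inv_naturality_left_assoc]
    simp)

@[simp]
theorem compLeft_ι (p : Bicomod c d) (q : Bicomod d e) :
    compLeft p q ≫ c.X ◁ ι p q = ι p q ≫ p.coactLeft ▷ q.X ≫ (α_ _ _ _).hom :=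
  liftLeft_ι _ _ _ _ _

theorem compLeft_ι_assoc (p : Bicomod c d) (q : Bicomod d e) {Z : V} (h : _ ⟶ Z) :
    compLeft p q ≫ c.X ◁ ι p q ≫ h = ι p q ≫ p.coactLeft ▷ q.X ≫ (α_ _ _ _).hom ≫ h := by
  rw [reassoc_of% (compLeft_ι p q)]

end Left

section Right

variable [∀ X : V, PreservesLimitsOfShape WalkingParallelPair (tensorRight X)]

instance mono_ι_whiskerRight (Z : V) (p : Bicomod c d) (q : Bicomod d e) : Mono (ι p q ▷ Z) :=
  mono_map_ι (tensorRight Z) p q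

instance mono_ι_whiskerRight₂ (Y Z : V) (p : Bicomod c d) (q : Bicomod d e) :
    Mono (ι p q ▷ Y ▷ Z) :=
  mono_map_ι (tensorRight Y ⋙ tensorRight Z) p q

/-- The morphism into `compX p q ⊗ Z` induced by an equalizing morphism. -/
noncomputable def liftRight (Z : V) (p : Bicomod c d) (q : Bicomod d e) {W : V}
    (k : W ⟶ (p.X ⊗ q.X) ⊗ Z)
    (h : k ≫ p.coactRight ▷ q.X ▷ Z =
      k ≫ (p.X ◁ q.coactLeft) ▷ Z ≫ (α_ _ _ _).inv ▷ Z) : W ⟶ compX p q ⊗ Z :=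
  Fork.IsLimit.lift (isLimitForkMapOfIsLimit (tensorRight Z) _ (equalizerIsEqualizer
    (p.coactRight ▷ q.X ≫ (α_ _ _ _).hom) (p.X ◁ q.coactLeft))) k (by
      simp only [tensorRight, Functor.flip_obj_map, curriedTensor_map_app, comp_whiskerRight]
      rw [reassoc_of% h, ← comp_whiskerRight, Iso.inv_hom_id]
      simp)

@[simp]
theorem liftRight_ι (Z : V) (p : Bicomod c d) (q : Bicomod d e) {W : V}
    (k : W ⟶ (p.X ⊗ q.X) ⊗ Z)
    (h : k ≫ p.coactRight ▷ q.X ▷ Z =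
      k ≫ (p.X ◁ q.coactLeft) ▷ Z ≫ (α_ _ _ _).inv ▷ Z) :
    liftRight Z p q k h ≫ ι p q ▷ Z = k :=
  Fork.IsLimit.lift_ι (isLimitForkMapOfIsLimit (tensorRight Z) _ (equalizerIsEqualizer
    (p.coactRight ▷ q.X ≫ (α_ _ _ _).hom) (p.X ◁ q.coactLeft)))

/-- The right coaction on a composite of bicomodules. -/
noncomputable def compRight (p : Bicomod c d) (q : Bicomod d e) :
    compX p q ⟶ compX p q ⊗ e.X :=
  liftRight e.X p q (ι p q ≫ p.X ◁ q.coactRight ≫ (α_ _ _ _).inv) (by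
    simp only [Category.assoc]
    rw [← associator_inv_naturality_middle_assoc, reassoc_of% (q.middle_whiskerLeft p.X),
      ← associator_inv_naturality_left, whisker_exchange_assoc, reassoc_of% (ι_condition p q)]
    simp)

@[simp]
theorem compRight_ι (p : Bicomod c d) (q : Bicomod d e) :
    compRight p q ≫ ι p q ▷ e.X = ι p q ≫ p.X ◁ q.coactRight ≫ (α_ _ _ _).inv :=
  liftRight_ι _ _ _ _ _

theorem compRight_ι_assoc (p : Bicomod c d) (q : Bicomod d e) {Z : V} (h : _ ⟶ Z) :
    compRight p q ≫ ι p q ▷ e.X ≫ h = ι p q ≫ p.X ◁ q.coactRight ≫ (α_ _ _ _).inv ≫ h := by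
  rw [reassoc_of% (compRight_ι p q)]

end Right

section Comp

variable [∀ X : V, PreservesLimitsOfShape WalkingParallelPair (tensorLeft X)]
variable [∀ X : V, PreservesLimitsOfShape WalkingParallelPair (tensorRight X)]

instance mono_whiskerLeft_ι_whiskerRight (Y Z : V) (p : Bicomod c d) (q : Bicomod d e) :
    Mono ((Y ◁ ι p q) ▷ Z) :=
  mono_map_ι (tensorLeft Y ⋙ tensorRight Z) p q

/-- The composite of bicomodules. -/
@[simps]
noncomputable abbrev comp (p : Bicomod c d) (q : Bicomod d e) : Bicomod c e where
  X := compX p q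
  coactLeft := compLeft p q
  coactRight := compRight p q
  left_counit := by
    rw [← cancel_mono (𝟙_ V ◁ ι p q)]
    rw [Category.assoc, ← whisker_exchange, compLeft_ι_assoc]
    rw [← associator_naturality_left]
    slice_lhs 2 3 => rw [← comp_whiskerRight, p.left_counit]
    simp
  left_comul := by
    rw [← cancel_mono (_ ◁ ι p q)]
    simp only [Category.assoc]
    rw [← whisker_exchange, compLeft_ι_assoc, ← associator_naturality_left,
      ← associator_inv_naturality_right]
    slice_lhs 2 3 => rw [← comp_whiskerRight, p.left_comul]
    slice_rhs 2 3 => rw [← whiskerLeft_comp, compLeft_ι]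
    slice_rhs 1 3 => rw [whiskerLeft_comp, compLeft_ι_assoc]
    simp
  right_counit := by
    rw [← cancel_mono (ι p q ▷ 𝟙_ V)]
    rw [Category.assoc, whisker_exchange, compRight_ι_assoc]
    rw [← associator_inv_naturality_right]
    slice_lhs 2 3 => rw [← whiskerLeft_comp, q.right_counit]
    simp
  right_comul := by
    rw [← cancel_mono (ι p q ▷ _)]
    simp only [Category.assoc]
    rw [whisker_exchange, compRight_ι_assoc, ← associator_inv_naturality_right,
      ← associator_naturality_left]
    slice_lhs 2 3 => rw [← whiskerLeft_comp, q.right_comul]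
    slice_rhs 2 3 => rw [← comp_whiskerRight, compRight_ι]
    slice_rhs 1 3 => rw [comp_whiskerRight, compRight_ι_assoc]
    simp
  middle := by
    rw [← cancel_mono ((c.X ◁ ι p q) ▷ e.X)]
    simp only [Category.assoc]
    rw [← comp_whiskerRight, compLeft_ι, comp_whiskerRight, compRight_ι_assoc,
      ← associator_inv_naturality_middle, ← whiskerLeft_comp_assoc, compRight_ι,
      whiskerLeft_comp_assoc, compLeft_ι_assoc]
    simp only [comp_whiskerRight, whiskerLeft_comp, Category.assoc]
    rw [← associator_inv_naturality_left_assoc, whisker_exchange_assoc,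
      ← associator_naturality_right_assoc]
    simp

@[simp]
theorem comp_left_ι (p : Bicomod c d) (q : Bicomod d e) :
    (comp p q).coactLeft ≫ c.X ◁ ι p q = ι p q ≫ p.coactLeft ▷ q.X ≫ (α_ _ _ _).hom :=
  compLeft_ι p q

theorem comp_left_ι_assoc (p : Bicomod c d) (q : Bicomod d e) {Z : V} (h : _ ⟶ Z) :
    (comp p q).coactLeft ≫ c.X ◁ ι p q ≫ h = ι p q ≫ p.coactLeft ▷ q.X ≫ (α_ _ _ _).hom ≫ h :=
  compLeft_ι_assoc p q h

@[simp]
theorem comp_right_ι (p : Bicomod c d) (q : Bicomod d e) :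
    (comp p q).coactRight ≫ ι p q ▷ e.X = ι p q ≫ p.X ◁ q.coactRight ≫ (α_ _ _ _).inv :=
  compRight_ι p q

theorem comp_right_ι_assoc (p : Bicomod c d) (q : Bicomod d e) {Z : V} (h : _ ⟶ Z) :
    (comp p q).coactRight ≫ ι p q ▷ e.X ≫ h =
      ι p q ≫ p.X ◁ q.coactRight ≫ (α_ _ _ _).inv ≫ h :=
  compRight_ι_assoc p q h

/-- A morphism of bicomodules into a composite, from its composite with the inclusion `ι`. -/
noncomputable def liftHom (p : Bicomod c d) (q : Bicomod d e) {r : Bicomod c e}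
    (k : r.X ⟶ p.X ⊗ q.X)
    (h : k ≫ p.coactRight ▷ q.X = k ≫ p.X ◁ q.coactLeft ≫ (α_ _ _ _).inv)
    (hl : r.coactLeft ≫ c.X ◁ k = k ≫ p.coactLeft ▷ q.X ≫ (α_ _ _ _).hom)
    (hr : r.coactRight ≫ k ▷ e.X = k ≫ p.X ◁ q.coactRight ≫ (α_ _ _ _).inv) :
    r ⟶ comp p q where
  hom := lift p q k h
  left := by
    have : Mono (c.X ◁ ι p q) := inferInstance
    refine (cancel_mono (c.X ◁ ι p q)).1 ?_
    rw [Category.assoc, Category.assoc, ← whiskerLeft_comp, lift_ι, hl, comp_left_ι,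
      ← Category.assoc (lift p q k h), lift_ι]
  right := by
    refine (cancel_mono (ι p q ▷ e.X)).1 ?_
    rw [Category.assoc, Category.assoc, ← comp_whiskerRight, lift_ι, hr, comp_right_ι,
      ← Category.assoc (lift p q k h), lift_ι]

@[simp]
theorem liftHom_ι (p : Bicomod c d) (q : Bicomod d e) {r : Bicomod c e}
    (k : r.X ⟶ p.X ⊗ q.X)
    (h : k ≫ p.coactRight ▷ q.X = k ≫ p.X ◁ q.coactLeft ≫ (α_ _ _ _).inv)
    (hl : r.coactLeft ≫ c.X ◁ k = k ≫ p.coactLeft ▷ q.X ≫ (α_ _ _ _).hom)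
    (hr : r.coactRight ≫ k ▷ e.X = k ≫ p.X ◁ q.coactRight ≫ (α_ _ _ _).inv) :
    (liftHom p q k h hl hr).hom ≫ ι p q = k :=
  lift_ι p q k h

theorem hom_ext_ι {p : Bicomod c d} {q : Bicomod d e} {r : Bicomod c e} {f g : r ⟶ comp p q}
    (h : f.hom ≫ ι p q = g.hom ≫ ι p q) : f = g :=
  hom_ext ((cancel_mono (ι p q)).1 h)

/-- Whiskering of a morphism of bicomodules on the left. -/
noncomputable def whiskerL (p : Bicomod c d) {q q' : Bicomod d e} (g : q ⟶ q') :
    comp p q ⟶ comp p q' :=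
  liftHom p q' (ι p q ≫ p.X ◁ g.hom)
    (by
      rw [Category.assoc, whisker_exchange, reassoc_of% (ι_condition p q)]
      rw [Category.assoc, ← whiskerLeft_comp_assoc, ← g.left]
      simp)
    (by
      rw [whiskerLeft_comp, comp_left_ι_assoc]
      simp [whisker_exchange_assoc])
    (by
      rw [comp_whiskerRight, comp_right_ι_assoc, Category.assoc, ← whiskerLeft_comp_assoc,
        ← g.right]
      simp)

/-- Whiskering of a morphism of bicomodules on the right. -/
noncomputable def whiskerR {p p' : Bicomod c d} (f : p ⟶ p') (q : Bicomod d e) :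
    comp p q ⟶ comp p' q :=
  liftHom p' q (ι p q ≫ f.hom ▷ q.X)
    (by
      rw [Category.assoc, ← comp_whiskerRight, ← f.right, comp_whiskerRight,
        reassoc_of% (ι_condition p q)]
      simp [← whisker_exchange_assoc])
    (by
      rw [whiskerLeft_comp, comp_left_ι_assoc, Category.assoc, ← comp_whiskerRight_assoc,
        ← f.left]
      simp)
    (by
      rw [comp_whiskerRight, comp_right_ι_assoc]
      simp [← whisker_exchange_assoc])

@[simp]
theorem whiskerL_ι (p : Bicomod c d) {q q' : Bicomod d e} (g : q ⟶ q') :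
    (whiskerL p g).hom ≫ ι p q' = ι p q ≫ p.X ◁ g.hom :=
  liftHom_ι _ _ _ _ _ _

theorem whiskerL_ι_assoc (p : Bicomod c d) {q q' : Bicomod d e} (g : q ⟶ q') {Z : V}
    (h : _ ⟶ Z) : (whiskerL p g).hom ≫ ι p q' ≫ h = ι p q ≫ p.X ◁ g.hom ≫ h := by
  rw [← Category.assoc, whiskerL_ι, Category.assoc]

@[simp]
theorem whiskerR_ι {p p' : Bicomod c d} (f : p ⟶ p') (q : Bicomod d e) :
    (whiskerR f q).hom ≫ ι p' q = ι p q ≫ f.hom ▷ q.X :=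
  liftHom_ι _ _ _ _ _ _

theorem whiskerR_ι_assoc {p p' : Bicomod c d} (f : p ⟶ p') (q : Bicomod d e) {Z : V}
    (h : _ ⟶ Z) : (whiskerR f q).hom ≫ ι p' q ≫ h = ι p q ≫ f.hom ▷ q.X ≫ h := by
  rw [← Category.assoc, whiskerR_ι, Category.assoc]

/-- The inverse of the left unitor. -/
noncomputable def leftUnitorInv (p : Bicomod c d) : p ⟶ comp (regular c) p :=
  liftHom (regular c) p p.coactLeft (by simp) (by simp [reassoc_of% p.left_comul])
    (by simp [p.middle])

@[simp]
theorem leftUnitorInv_ι (p : Bicomod c d) :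
    (leftUnitorInv p).hom ≫ ι (regular c) p = p.coactLeft :=
  liftHom_ι _ _ _ _ _ _

/-- The left unitor for composition of bicomodules. -/
noncomputable def leftUnitor (p : Bicomod c d) : comp (regular c) p ≅ p :=
  (isoMk (leftUnitorInv p)
    (ι (regular c) p ≫ ε[c.X] ▷ p.X ≫ (λ_ p.X).hom)
    (by
      rw [← Category.assoc, leftUnitorInv_ι, reassoc_of% p.left_counit]
      simp)
    (by
      refine (cancel_mono (ι (regular c) p)).1 ?_
      simp only [Category.assoc, leftUnitorInv_ι]
      rw [← leftUnitor_naturality, ← whisker_exchange_assoc]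
      have := ι_condition (regular c) p
      have h : ι (regular c) p ≫ c.X ◁ p.coactLeft =
          ι (regular c) p ≫ Δ[c.X] ▷ p.X ≫ (α_ _ _ _).hom := by
        rw [reassoc_of% this]
        simp
      rw [reassoc_of% h, ← associator_naturality_left_assoc, ← comp_whiskerRight_assoc,
        counit_comul]
      simp)).symm

/-- The inverse of the right unitor. -/
noncomputable def rightUnitorInv (p : Bicomod c d) : p ⟶ comp p (regular d) :=
  liftHom p (regular d) p.coactRight (by simp [reassoc_of% p.right_comul])
    (by simp [reassoc_of% p.middle]) (by simp [reassoc_of% p.right_comul])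

@[simp]
theorem rightUnitorInv_ι (p : Bicomod c d) :
    (rightUnitorInv p).hom ≫ ι p (regular d) = p.coactRight :=
  liftHom_ι _ _ _ _ _ _

/-- The right unitor for composition of bicomodules. -/
noncomputable def rightUnitor (p : Bicomod c d) : comp p (regular d) ≅ p :=
  (isoMk (rightUnitorInv p)
    (ι p (regular d) ≫ p.X ◁ ε[d.X] ≫ (ρ_ p.X).hom)
    (by
      rw [← Category.assoc, rightUnitorInv_ι, reassoc_of% p.right_counit]
      simp)
    (by
      refine (cancel_mono (ι p (regular d))).1 ?_
      simp only [Category.assoc, rightUnitorInv_ι]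
      rw [← rightUnitor_naturality, whisker_exchange_assoc, reassoc_of% (ι_condition p (regular d)),
        ← associator_inv_naturality_right_assoc, ← whiskerLeft_comp_assoc]
      simp)).symm

@[simp]
theorem leftUnitor_hom (p : Bicomod c d) :
    (leftUnitor p).hom.hom = ι (regular c) p ≫ ε[c.X] ▷ p.X ≫ (λ_ p.X).hom := rfl

@[simp]
theorem leftUnitor_inv_ι (p : Bicomod c d) :
    (leftUnitor p).inv.hom ≫ ι (regular c) p = p.coactLeft :=
  leftUnitorInv_ι p

@[simp]
theorem rightUnitor_hom (p : Bicomod c d) :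
    (rightUnitor p).hom.hom = ι p (regular d) ≫ p.X ◁ ε[d.X] ≫ (ρ_ p.X).hom := rfl

@[simp]
theorem rightUnitor_inv_ι (p : Bicomod c d) :
    (rightUnitor p).inv.hom ≫ ι p (regular d) = p.coactRight :=
  rightUnitorInv_ι p

section Associator

variable (p : Bicomod b c) (q : Bicomod c d) (r : Bicomod d e)

/-- The associator for composition of bicomodules, as a map into a partial composite. -/
noncomputable def assocAux : (comp (comp p q) r).X ⟶ p.X ⊗ (comp q r).X :=
  liftLeft p.X q r (ι (comp p q) r ≫ ι p q ▷ r.X ≫ (α_ _ _ _).hom) (by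
    have h : ι p q ≫ p.X ◁ q.coactRight = compRight p q ≫ ι p q ▷ d.X ≫ (α_ _ _ _).hom := by
      rw [compRight_ι_assoc]
      simp
    simp only [Category.assoc]
    rw [← associator_naturality_middle, ← comp_whiskerRight_assoc, h, comp_whiskerRight_assoc,
      reassoc_of% (ι_condition (comp p q) r), ← associator_naturality_right_assoc,
      ← whisker_exchange_assoc]
    simp)

@[simp]
theorem assocAux_ι :
    assocAux p q r ≫ p.X ◁ ι q r = ι (comp p q) r ≫ ι p q ▷ r.X ≫ (α_ _ _ _).hom :=
  liftLeft_ι _ _ _ _ _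

theorem assocAux_ι_assoc {Z : V} (h : _ ⟶ Z) :
    assocAux p q r ≫ p.X ◁ ι q r ≫ h = ι (comp p q) r ≫ ι p q ▷ r.X ≫ (α_ _ _ _).hom ≫ h := by
  rw [reassoc_of% (assocAux_ι p q r)]

/-- The associator for composition of bicomodules. -/
noncomputable def assocHom : comp (comp p q) r ⟶ comp p (comp q r) :=
  liftHom p (comp q r) (assocAux p q r)
    (by
      refine (cancel_mono (_ ◁ ι q r)).1 ?_
      simp only [Category.assoc]
      rw [← whisker_exchange, assocAux_ι_assoc, ← associator_naturality_left,
        ← comp_whiskerRight_assoc, ι_condition, ← associator_inv_naturality_right,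
        ← whiskerLeft_comp_assoc, comp_left_ι, whiskerLeft_comp_assoc, assocAux_ι_assoc]
      simp)
    (by
      refine (cancel_mono (_ ◁ _ ◁ ι q r)).1 ?_
      simp only [Category.assoc]
      rw [← whiskerLeft_comp, assocAux_ι, whiskerLeft_comp, whiskerLeft_comp,
        comp_left_ι_assoc, ← associator_naturality_right, ← whisker_exchange_assoc,
        assocAux_ι_assoc, ← associator_naturality_middle_assoc, ← comp_whiskerRight_assoc,
        comp_left_ι]
      simp)
    (by
      refine (cancel_mono ((_ ◁ ι q r) ▷ _)).1 ?_
      simp only [Category.assoc]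
      rw [← comp_whiskerRight, assocAux_ι, comp_whiskerRight, comp_whiskerRight,
        comp_right_ι_assoc, ← associator_inv_naturality_middle, ← whiskerLeft_comp_assoc,
        comp_right_ι, whiskerLeft_comp_assoc, assocAux_ι_assoc,
        ← associator_inv_naturality_left_assoc, whisker_exchange_assoc]
      simp)

theorem assocHom_ι_assoc {Z : V} (h : _ ⟶ Z) :
    (assocHom p q r).hom ≫ ι p (comp q r) ≫ h = assocAux p q r ≫ h := by
  rw [← Category.assoc]
  congr 1
  exact liftHom_ι _ _ _ _ _ _

/-- The inverse of the associator for composition of bicomodules, as a map into a partial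
composite. -/
noncomputable def assocInvAux : (comp p (comp q r)).X ⟶ (comp p q).X ⊗ r.X :=
  liftRight r.X p q (ι p (comp q r) ≫ p.X ◁ ι q r ≫ (α_ _ _ _).inv) (by
    simp only [Category.assoc]
    rw [← associator_inv_naturality_left, whisker_exchange_assoc,
      reassoc_of% (ι_condition p (comp q r)), ← associator_inv_naturality_right_assoc,
      ← whiskerLeft_comp_assoc, comp_left_ι, whiskerLeft_comp_assoc]
    simp)

@[simp]
theorem assocInvAux_ι :
    assocInvAux p q r ≫ ι p q ▷ r.X = ι p (comp q r) ≫ p.X ◁ ι q r ≫ (α_ _ _ _).inv :=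
  liftRight_ι _ _ _ _ _

theorem assocInvAux_ι_assoc {Z : V} (h : _ ⟶ Z) :
    assocInvAux p q r ≫ ι p q ▷ r.X ≫ h =
      ι p (comp q r) ≫ p.X ◁ ι q r ≫ (α_ _ _ _).inv ≫ h := by
  rw [reassoc_of% (assocInvAux_ι p q r)]

/-- The inverse of the associator on carriers. -/
noncomputable def assocInv : (comp p (comp q r)).X ⟶ (comp (comp p q) r).X :=
  lift (comp p q) r (assocInvAux p q r) (by
    refine (cancel_mono (ι p q ▷ _ ▷ _)).1 ?_
    simp only [Category.assoc]
    rw [← comp_whiskerRight, comp_right_ι, comp_whiskerRight, assocInvAux_ι_assoc,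
      ← associator_inv_naturality_left, whisker_exchange_assoc, assocInvAux_ι_assoc]
    rw [comp_whiskerRight, ← associator_inv_naturality_middle_assoc, ← whiskerLeft_comp_assoc,
      ι_condition, ← associator_inv_naturality_right_assoc]
    simp)

theorem assocInv_ι_assoc {Z : V} (h : _ ⟶ Z) :
    assocInv p q r ≫ ι (comp p q) r ≫ h = assocInvAux p q r ≫ h := by
  rw [← Category.assoc]
  congr 1
  exact lift_ι _ _ _ _

/-- The associator for composition of bicomodules. -/
noncomputable def associator : comp (comp p q) r ≅ comp p (comp q r) :=
  isoMk (assocHom p q r) (assocInv p q r)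
    (by
      refine (cancel_mono (ι (comp p q) r)).1 ((cancel_mono (ι p q ▷ r.X)).1 ?_)
      rw [Category.assoc, Category.assoc, Category.assoc, assocInv_ι_assoc, assocInvAux_ι,
        assocHom_ι_assoc, assocAux_ι_assoc]
      simp)
    (by
      refine (cancel_mono (ι p (comp q r))).1 ((cancel_mono (p.X ◁ ι q r)).1 ?_)
      rw [Category.assoc, Category.assoc, Category.assoc, assocHom_ι_assoc, assocAux_ι,
        assocInv_ι_assoc, assocInvAux_ι_assoc]
      simp)

/-- The associator is characterized by its compatibility with the associator of the ambient
monoidal category. -/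
theorem associator_hom_ι_assoc {Z : V} (h : _ ⟶ Z) :
    (associator p q r).hom.hom ≫ ι p (comp q r) ≫ p.X ◁ ι q r ≫ h =
      ι (comp p q) r ≫ ι p q ▷ r.X ≫ (α_ _ _ _).hom ≫ h :=
  (assocHom_ι_assoc p q r _).trans (assocAux_ι_assoc p q r h)

theorem associator_inv_ι_assoc {Z : V} (h : _ ⟶ Z) :
    (associator p q r).inv.hom ≫ ι (comp p q) r ≫ ι p q ▷ r.X ≫ h =
      ι p (comp q r) ≫ p.X ◁ ι q r ≫ (α_ _ _ _).inv ≫ h :=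
  (assocInv_ι_assoc p q r _).trans (assocInvAux_ι_assoc p q r h)

theorem associator_hom_ι :
    (associator p q r).hom.hom ≫ ι p (comp q r) ≫ p.X ◁ ι q r =
      ι (comp p q) r ≫ ι p q ▷ r.X ≫ (α_ _ _ _).hom :=
  (assocHom_ι_assoc p q r _).trans (assocAux_ι p q r)

theorem associator_inv_ι :
    (associator p q r).inv.hom ≫ ι (comp p q) r ≫ ι p q ▷ r.X =
      ι p (comp q r) ≫ p.X ◁ ι q r ≫ (α_ _ _ _).inv :=
  (assocInv_ι_assoc p q r _).trans (assocInvAux_ι p q r)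

/-- Morphisms into a composite of three bicomodules, bracketed to the right, agree if they agree
after inclusion into the triple tensor product. -/
theorem hom_ext_ι₃ {s : Bicomod b e} {f g : s ⟶ comp p (comp q r)}
    (h : f.hom ≫ ι p (comp q r) ≫ p.X ◁ ι q r = g.hom ≫ ι p (comp q r) ≫ p.X ◁ ι q r) : f = g :=
  hom_ext_ι ((cancel_mono (p.X ◁ ι q r)).1 (by simpa only [Category.assoc] using h))

/-- Morphisms into a composite of three bicomodules, bracketed to the left, agree if they agree
after inclusion into the triple tensor product. -/
theorem hom_ext_ι₃' {s : Bicomod b e} {f g : s ⟶ comp (comp p q) r}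
    (h : f.hom ≫ ι (comp p q) r ≫ ι p q ▷ r.X = g.hom ≫ ι (comp p q) r ≫ ι p q ▷ r.X) : f = g :=
  hom_ext_ι ((cancel_mono (ι p q ▷ r.X)).1 (by simpa only [Category.assoc] using h))

end Associator

variable {a : Comon V}

theorem pentagon (p : Bicomod a b) (q : Bicomod b c) (r : Bicomod c d) (s : Bicomod d e) :
    whiskerR (associator p q r).hom s ≫ (associator p (comp q r) s).hom ≫
      whiskerL p (associator q r s).hom =
    (associator (comp p q) r s).hom ≫ (associator p q (comp r s)).hom := by
  refine hom_ext_ι₃ _ _ _ ((cancel_mono (p.X ◁ q.X ◁ ι r s)).1 ?_)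
  simp only [comp_hom, Category.assoc]
  rw [whiskerL_ι_assoc, ← whiskerLeft_comp, ← whiskerLeft_comp, associator_hom_ι,
    whiskerLeft_comp, whiskerLeft_comp, associator_hom_ι_assoc, whiskerR_ι_assoc]
  rw [← associator_naturality_middle_assoc, ← comp_whiskerRight_assoc, ← comp_whiskerRight_assoc,
    Category.assoc, associator_hom_ι, comp_whiskerRight_assoc, comp_whiskerRight_assoc,
    whiskerLeft_comp, associator_hom_ι_assoc, ← associator_naturality_right,
    ← whisker_exchange_assoc, associator_hom_ι_assoc]
  simp

theorem triangle (p : Bicomod a b) (q : Bicomod b c) :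
    (associator p (regular b) q).hom ≫ whiskerL p (leftUnitor q).hom =
      whiskerR (rightUnitor p).hom q := by
  refine hom_ext_ι ?_
  simp only [comp_hom, Category.assoc]
  rw [whiskerL_ι, leftUnitor_hom, whiskerLeft_comp, associator_hom_ι_assoc, whiskerR_ι,
    rightUnitor_hom]
  simp

theorem id_whiskerL {p q : Bicomod a b} (f : p ⟶ q) :
    whiskerL (regular a) f = (leftUnitor p).hom ≫ f ≫ (leftUnitor q).inv := by
  rw [← Iso.inv_comp_eq]
  refine hom_ext_ι ?_
  simp only [comp_hom, Category.assoc]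
  rw [whiskerL_ι, leftUnitor_inv_ι, ← f.left, ← Category.assoc, leftUnitor_inv_ι]

theorem whiskerR_id {p q : Bicomod a b} (f : p ⟶ q) :
    whiskerR f (regular b) = (rightUnitor p).hom ≫ f ≫ (rightUnitor q).inv := by
  rw [← Iso.inv_comp_eq]
  refine hom_ext_ι ?_
  simp only [comp_hom, Category.assoc]
  rw [whiskerR_ι, rightUnitor_inv_ι, ← f.right, ← Category.assoc, rightUnitor_inv_ι]

theorem comp_whiskerL (p : Bicomod a b) (q : Bicomod b c) {r r' : Bicomod c d} (f : r ⟶ r') :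
    whiskerL (comp p q) f =
      (associator p q r).hom ≫ whiskerL p (whiskerL q f) ≫ (associator p q r').inv := by
  refine hom_ext_ι₃' _ _ _ ?_
  simp only [comp_hom, Category.assoc]
  rw [associator_inv_ι, whiskerL_ι_assoc, whiskerL_ι_assoc, whisker_exchange,
    ← whiskerLeft_comp_assoc, whiskerL_ι, whiskerLeft_comp_assoc, associator_hom_ι_assoc]
  simp

theorem whiskerR_comp {p p' : Bicomod a b} (f : p ⟶ p') (q : Bicomod b c) (r : Bicomod c d) :
    whiskerR f (comp q r) =
      (associator p q r).inv ≫ whiskerR (whiskerR f q) r ≫ (associator p' q r).hom := by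
  refine hom_ext_ι₃ _ _ _ ?_
  simp only [comp_hom, Category.assoc]
  rw [associator_hom_ι, whiskerR_ι_assoc, whiskerR_ι_assoc, ← whisker_exchange,
    ← comp_whiskerRight_assoc, whiskerR_ι, comp_whiskerRight_assoc, associator_inv_ι_assoc]
  simp

theorem whisker_assoc (p : Bicomod a b) {q q' : Bicomod b c} (f : q ⟶ q') (r : Bicomod c d) :
    whiskerR (whiskerL p f) r =
      (associator p q r).hom ≫ whiskerL p (whiskerR f r) ≫ (associator p q' r).inv := by
  refine hom_ext_ι₃' _ _ _ ?_
  simp only [comp_hom, Category.assoc]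
  rw [associator_inv_ι, whiskerL_ι_assoc, whiskerR_ι_assoc, ← comp_whiskerRight, whiskerL_ι,
    ← whiskerLeft_comp_assoc, whiskerR_ι, whiskerLeft_comp_assoc, associator_hom_ι_assoc]
  simp

theorem whisker_comm {p p' : Bicomod a b} {q q' : Bicomod b c} (f : p ⟶ p') (g : q ⟶ q') :
    whiskerL p g ≫ whiskerR f q' = whiskerR f q ≫ whiskerL p' g := by
  refine hom_ext_ι ?_
  simp only [comp_hom, Category.assoc]
  rw [whiskerR_ι, whiskerL_ι_assoc, whisker_exchange, whiskerL_ι, whiskerR_ι_assoc]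

end Comp

end Bicomod

end Bicomodules

/-! ## The bicategory of categories (polynomial comonoids) and bicomodules -/

/-- An object of the double category of comonoids in polynomials, that is, a polynomial
comonoid (equivalently a small category). -/
structure CatSharp : Type (u + 1) where
  /-- The comonoid. -/
  comon : CategoryTheory.Comon PFunctor.{u, u}

namespace CatSharp

open CategoryTheory MonoidalCategory

/-- The horizontal bicategory of the double category of polynomial comonoids: the 1-cells `c ⟶ d`
are the `(c, d)`-bicomodules, with composition given by the equalizer of
`p ◁ q ⇉ p ◁ d ◁ q`, and the 2-cells are the morphisms of bicomodules. -/
noncomputable instance bicategory : Bicategory CatSharp.{u} where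
  Hom c d := Bicomod c.comon d.comon
  id c := Bicomod.regular c.comon
  comp p q := Bicomod.comp p q
  homCategory _ _ := inferInstance
  whiskerLeft p _ _ f := Bicomod.whiskerL p f
  whiskerRight f q := Bicomod.whiskerR f q
  associator := Bicomod.associator
  leftUnitor := Bicomod.leftUnitor
  rightUnitor := Bicomod.rightUnitor
  whiskerLeft_id _ _ := Bicomod.hom_ext_ι (by simp)
  whiskerLeft_comp _ _ _ _ _ _ := Bicomod.hom_ext_ι (by simp [Bicomod.whiskerL_ι_assoc])
  id_whiskerLeft := Bicomod.id_whiskerL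
  comp_whiskerLeft p q _ _ f := Bicomod.comp_whiskerL p q f
  id_whiskerRight _ _ := Bicomod.hom_ext_ι (by simp)
  comp_whiskerRight _ _ _ := Bicomod.hom_ext_ι (by simp [Bicomod.whiskerR_ι_assoc])
  whiskerRight_id := Bicomod.whiskerR_id
  whiskerRight_comp f q r := Bicomod.whiskerR_comp f q r
  whisker_assoc p _ _ f r := Bicomod.whisker_assoc p f r
  whisker_exchange f g := Bicomod.whisker_comm f g
  pentagon := Bicomod.pentagon
  triangle := Bicomod.triangle

end CatSharp

/-! ## Monads, left Kan extensions and comonads in a bicategory -/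

namespace BicategoryKan

open CategoryTheory Bicategory

universe w' v' u'

variable {B : Type u'} [Bicategory.{w', v'} B] {c d : B}

section Laws

variable (m : c ⟶ c) [MonObj m]

/-- The unit of a monad in a bicategory. -/
def unit : 𝟙 c ⟶ m := MonObj.one (X := m)

/-- The multiplication of a monad in a bicategory. -/
def mult : m ≫ m ⟶ m := MonObj.mul (X := m)

theorem unit_mult : unit m ▷ m ≫ mult m = (λ_ m).hom := MonObj.one_mul m

theorem mult_unit : m ◁ unit m ≫ mult m = (ρ_ m).hom := MonObj.mul_one m

theorem mult_assoc : mult m ▷ m ≫ mult m = (α_ m m m).hom ≫ m ◁ mult m ≫ mult m :=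
  MonObj.mul_assoc m

/-- The monad on the hom-category `c ⟶ z` given by composition with a monad `m` on `c`. -/
@[simps]
def homMonad (z : B) : Monad (c ⟶ z) where
  obj X := m ≫ X
  map f := m ◁ f
  η := { app := fun X => (λ_ X).inv ≫ unit m ▷ X
         naturality := by intros; simp [← whisker_exchange] }
  μ := { app := fun X => (α_ m m X).inv ≫ mult m ▷ X
         naturality := by intros; simp [← whisker_exchange] }
  assoc X := by
    have h := congrArg (· ▷ X) (mult_assoc m)
    simp only [comp_whiskerRight] at h
    simp only [whiskerLeft_comp, Category.assoc]
    rw [associator_inv_naturality_left_assoc, h]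
    simp
  left_unit X := by
    have h := congrArg (· ▷ X) (unit_mult m)
    simp only [comp_whiskerRight] at h
    simp only [Category.assoc]
    rw [associator_inv_naturality_left_assoc, h]
    simp
  right_unit X := by
    have h := congrArg (· ▷ X) (mult_unit m)
    simp only [comp_whiskerRight] at h
    simp only [whiskerLeft_comp, Category.assoc]
    rw [associator_inv_naturality_middle_assoc, h]
    simp

end Laws

section KanComonad

variable (m : c ⟶ c) [MonObj m] (p : d ⟶ c)

/-- The morphism `p ⟶ p ≫ m` given by the unit of `m`. -/
def compUnit : p ⟶ p ≫ m := (ρ_ p).inv ≫ p ◁ unit m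

/-- The morphism `(p ≫ m) ≫ m ⟶ p ≫ m` given by the multiplication of `m`. -/
def compMult : (p ≫ m) ≫ m ⟶ p ≫ m := (α_ p m m).hom ≫ p ◁ mult m

theorem compUnit_compMult : compUnit m p ▷ m ≫ compMult m p = 𝟙 _ := by
  have h := congrArg (p ◁ ·) (unit_mult m)
  simp only [whiskerLeft_comp] at h
  simp [compUnit, compMult, h]

theorem compMult_compUnit : (p ≫ m) ◁ unit m ≫ compMult m p = (ρ_ (p ≫ m)).hom := by
  have h := congrArg (p ◁ ·) (mult_unit m)
  simp only [whiskerLeft_comp] at h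
  simp [compMult, h]

theorem compMult_assoc : compMult m p ▷ m ≫ compMult m p =
    (α_ _ _ _).hom ≫ (p ≫ m) ◁ mult m ≫ compMult m p := by
  have h := congrArg (p ◁ ·) (mult_assoc m)
  simp only [whiskerLeft_comp] at h
  simp [compMult, h]

variable {m p} (t : LeftLift (p ≫ m) p)

/-- The composite `p ≫ m ⟶ L ≫ (p ≫ m)` of the unit of the Kan extension `L` with the
multiplication of `m`. -/
def kanAct : p ≫ m ⟶ t.lift ≫ (p ≫ m) :=
  t.unit ▷ m ≫ (α_ _ _ _).hom ≫ t.lift ◁ compMult m p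

theorem compUnit_kanAct : compUnit m p ≫ kanAct t = t.unit := by
  have h := congrArg (t.lift ◁ ·) (compMult_compUnit m p)
  simp only [whiskerLeft_comp] at h
  simp only [compUnit, kanAct, Category.assoc]
  rw [whisker_exchange_assoc, associator_naturality_right_assoc, h]
  simp

theorem kanAct_compMult :
    kanAct t ▷ m ≫ (α_ _ _ _).hom ≫ t.lift ◁ compMult m p = compMult m p ≫ kanAct t := by
  have h := congrArg (t.lift ◁ ·) (compMult_assoc m p)
  simp only [whiskerLeft_comp] at h
  simp only [kanAct, comp_whiskerRight, Category.assoc]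
  rw [associator_naturality_middle_assoc, h]
  have e : compMult m p ≫ t.unit ▷ m = t.unit ▷ m ▷ m ≫ (α_ _ _ _).hom ≫
      (t.lift ≫ (p ≫ m)) ◁ mult m := by
    simp only [compMult, Category.assoc]
    rw [whisker_exchange, associator_naturality_left_assoc]
  rw [reassoc_of% e]
  congr 1
  simp

variable {t} (H : t.IsKan)

/-- The counit of the left Kan extension of `p` along `p ≫ m`, corresponding to the morphism
`p ⟶ p ≫ m ≅ 𝟙 d ≫ (p ≫ m)` given by the unit of `m`. -/
def kanCounit : t.lift ⟶ 𝟙 d :=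
  H.desc (LeftLift.mk (𝟙 d) (compUnit m p ≫ (λ_ (p ≫ m)).inv))

/-- The comultiplication of the left Kan extension `L` of `p` along `p ≫ m`, corresponding to
the composite `p ⟶ L ≫ (p ≫ m) ⟶ L ≫ ((L ≫ (p ≫ m)) ≫ m) ⟶ (L ≫ L) ≫ (p ≫ m)` of two
applications of the unit of the Kan extension and the multiplication of `m`. -/
def kanComul : t.lift ⟶ t.lift ≫ t.lift :=
  H.desc (LeftLift.mk (t.lift ≫ t.lift)
    (t.unit ≫ t.lift ◁ (t.unit ▷ m ≫ (α_ _ _ _).hom ≫ t.lift ◁ compMult m p) ≫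
      (α_ t.lift t.lift (p ≫ m)).inv))

theorem unit_kanCounit : t.unit ≫ kanCounit H ▷ (p ≫ m) = compUnit m p ≫ (λ_ (p ≫ m)).inv :=
  H.fac _

theorem unit_kanComul : t.unit ≫ kanComul H ▷ (p ≫ m) =
    t.unit ≫ t.lift ◁ kanAct t ≫ (α_ t.lift t.lift (p ≫ m)).inv :=
  H.fac _

theorem kanAct_kanCounit : kanAct t ≫ kanCounit H ▷ (p ≫ m) = (λ_ (p ≫ m)).inv := by
  have h := congrArg (· ▷ m) (unit_kanCounit H)
  simp only [comp_whiskerRight] at h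
  simp only [kanAct, Category.assoc]
  rw [whisker_exchange, ← associator_naturality_left_assoc, reassoc_of% h]
  rw [leftUnitor_inv_whiskerRight_assoc, Iso.inv_hom_id_assoc, ← leftUnitor_inv_naturality,
    ← Category.assoc, compUnit_compMult, Category.id_comp]

theorem kanAct_kanComul : kanAct t ≫ kanComul H ▷ (p ≫ m) =
    kanAct t ≫ t.lift ◁ kanAct t ≫ (α_ t.lift t.lift (p ≫ m)).inv := by
  have h := congrArg (· ▷ m) (unit_kanComul H)
  simp only [comp_whiskerRight] at h
  have h₂ := congrArg (t.lift ◁ ·) (kanAct_compMult t)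
  simp only [whiskerLeft_comp] at h₂
  change (t.unit ▷ m ≫ (α_ _ _ _).hom ≫ t.lift ◁ compMult m p) ≫ kanComul H ▷ (p ≫ m) =
    (t.unit ▷ m ≫ (α_ _ _ _).hom ≫ t.lift ◁ compMult m p) ≫ t.lift ◁ kanAct t ≫
      (α_ t.lift t.lift (p ≫ m)).inv
  simp only [Category.assoc]
  rw [whisker_exchange, ← associator_naturality_left_assoc, reassoc_of% h, ← reassoc_of% h₂]
  congr 1
  bicategory

/-- The comonad structure on the left Kan extension of `p` along `p ≫ m`. -/
@[reducible]
def kanComonad : Comonad t.lift where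
  counit := kanCounit H
  comul := kanComul H
  counit_comul := by
    refine H.hom_ext ?_
    change t.unit ≫ (kanComul H ≫ kanCounit H ▷ t.lift) ▷ (p ≫ m) =
      t.unit ≫ (λ_ t.lift).inv ▷ (p ≫ m)
    rw [comp_whiskerRight, reassoc_of% (unit_kanComul H), ← associator_inv_naturality_left,
      whisker_exchange_assoc, reassoc_of% (unit_kanCounit H), ← leftUnitor_inv_naturality_assoc,
      reassoc_of% (compUnit_kanAct t)]
    simp
  comul_counit := by
    refine H.hom_ext ?_
    change t.unit ≫ (kanComul H ≫ t.lift ◁ kanCounit H) ▷ (p ≫ m) =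
      t.unit ≫ (ρ_ t.lift).inv ▷ (p ≫ m)
    rw [comp_whiskerRight, reassoc_of% (unit_kanComul H), ← associator_inv_naturality_middle,
      ← whiskerLeft_comp_assoc, kanAct_kanCounit]
    simp
  comul_assoc := by
    refine H.hom_ext ?_
    change t.unit ≫ (kanComul H ≫ t.lift ◁ kanComul H) ▷ (p ≫ m) =
      t.unit ≫ (kanComul H ≫ kanComul H ▷ t.lift ≫ (α_ _ _ _).hom) ▷ (p ≫ m)
    rw [comp_whiskerRight, comp_whiskerRight, comp_whiskerRight, reassoc_of% (unit_kanComul H),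
      reassoc_of% (unit_kanComul H), ← associator_inv_naturality_middle,
      ← associator_inv_naturality_left_assoc, whisker_exchange_assoc,
      reassoc_of% (unit_kanComul H),
      ← whiskerLeft_comp_assoc, kanAct_kanComul]
    bicategory

end KanComonad

end BicategoryKan

/-! ## The comonoid of a category, and the carrier comonoid of a comonad -/

namespace CatSharp

open CategoryTheory MonoidalCategory PFunctor ComonObj

/-- The polynomial comonoid corresponding to a small category: its positions are the objects, its
directions at `C` are the morphisms out of `C`, the counit picks out identities, and the
comultiplication consists of codomains and composition. -/
def ofCategory (K : Type u) [SmallCategory K] : Comon PFunctor.{u, u} where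
  X := ⟨K, fun C => Σ C' : K, C ⟶ C'⟩
  comon :=
    { counit := Lens.mk (fun _ => PUnit.unit) (fun C _ => ⟨C, 𝟙 C⟩)
      comul := Lens.mk (fun C => ⟨C, fun f => f.1⟩) (fun _ z => ⟨z.2.1, z.1.2 ≫ z.2.2⟩)
      counit_comul := Lens.ext_atPos fun _ => congrArg (Sigma.mk _) (funext fun z =>
        Sigma.ext rfl (heq_of_eq (Category.id_comp z.2.2)))
      comul_counit := Lens.ext_atPos fun _ => congrArg (Sigma.mk _) (funext fun z =>
        Sigma.ext rfl (heq_of_eq (Category.comp_id z.1.2)))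
      comul_assoc := Lens.ext_atPos fun _ => congrArg (Sigma.mk _) (funext fun _ =>
        Sigma.ext rfl (heq_of_eq (Category.assoc _ _ _).symm)) }

/-- The polynomial carrying a bicomodule. -/
abbrev carrier {c d : CatSharp.{u}} (p : c ⟶ d) : PFunctor.{u, u} :=
  Bicomod.X (c := c.comon) (d := d.comon) p

/-- The morphism of polynomials underlying a morphism of bicomodules. -/
abbrev toPoly {c d : CatSharp.{u}} {p q : c ⟶ d} (f : p ⟶ q) : carrier p ⟶ carrier q :=
  Bicomod.Hom.hom (c := c.comon) (d := d.comon) f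

/-- The inclusion of the composite bicomodule `p ◁_d q` into the composite polynomial `p ◁ q`. -/
noncomputable abbrev incl {c d e : CatSharp.{u}} (p : c ⟶ d) (q : d ⟶ e) :
    carrier (p ≫ q) ⟶ carrier p ⊗ carrier q :=
  Bicomod.ι (c := c.comon) (d := d.comon) (e := e.comon) p q

section CarrierComonoid

variable {d : CatSharp.{u}} (e : d ⟶ d) [Bicategory.Comonad e]

/-- The counit of the carrier comonoid of a comonad. -/
noncomputable def carrierCounit : carrier e ⟶ 𝟙_ PFunctor.{u, u} :=
  toPoly (Bicategory.Comonad.counit (t := e)) ≫ ε[d.comon.X]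

/-- The comultiplication of the carrier comonoid of a comonad. -/
noncomputable def carrierComul : carrier e ⟶ carrier e ⊗ carrier e :=
  toPoly (Bicategory.Comonad.comul (t := e)) ≫ incl e e

theorem counit_left : toPoly (Bicategory.Comonad.comul (t := e)) ≫ incl e e ≫
    toPoly (Bicategory.Comonad.counit (t := e)) ▷ carrier e =
      Bicomod.coactLeft (c := d.comon) (d := d.comon) e := by
  have h : toPoly (Bicategory.Comonad.comul (t := e)) ≫
      Bicomod.Hom.hom (Bicomod.whiskerR (Bicategory.Comonad.counit (t := e)) e) =
        Bicomod.Hom.hom (Bicomod.leftUnitor e).inv :=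
    congrArg Bicomod.Hom.hom (Bicategory.Comonad.counit_comul (t := e))
  have h₂ := congrArg (· ≫ Bicomod.ι _ _) h
  simp only [Category.assoc] at h₂
  exact ((congrArg (_ ≫ ·) (Bicomod.whiskerR_ι _ _)).symm.trans h₂).trans
    (Bicomod.leftUnitor_inv_ι _)

theorem counit_right : toPoly (Bicategory.Comonad.comul (t := e)) ≫ incl e e ≫
    carrier e ◁ toPoly (Bicategory.Comonad.counit (t := e)) =
      Bicomod.coactRight (c := d.comon) (d := d.comon) e := by
  have h : toPoly (Bicategory.Comonad.comul (t := e)) ≫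
      Bicomod.Hom.hom (Bicomod.whiskerL e (Bicategory.Comonad.counit (t := e))) =
        Bicomod.Hom.hom (Bicomod.rightUnitor e).inv :=
    congrArg Bicomod.Hom.hom (Bicategory.Comonad.comul_counit (t := e))
  have h₂ := congrArg (· ≫ Bicomod.ι _ _) h
  simp only [Category.assoc] at h₂
  exact ((congrArg (_ ≫ ·) (Bicomod.whiskerL_ι _ _)).symm.trans h₂).trans
    (Bicomod.rightUnitor_inv_ι _)

theorem comul_comul : carrierComul e ≫ carrier e ◁ carrierComul e =
    carrierComul e ≫ carrierComul e ▷ carrier e ≫ (α_ _ _ _).hom := by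
  let D := Bicategory.Comonad.comul (t := e)
  have h : toPoly D ≫ Bicomod.Hom.hom (Bicomod.whiskerL e D) =
      toPoly D ≫ Bicomod.Hom.hom (Bicomod.whiskerR D e) ≫
        Bicomod.Hom.hom (Bicomod.associator e e e).hom :=
    congrArg Bicomod.Hom.hom (Bicategory.Comonad.comul_assoc (t := e))
  have h₁ : toPoly D ≫ Bicomod.ι e e ≫ e.X ◁ D.hom ≫ e.X ◁ Bicomod.ι e e =
      toPoly D ≫ Bicomod.Hom.hom (Bicomod.whiskerL e D) ≫
        Bicomod.ι e (Bicomod.comp e e) ≫ e.X ◁ Bicomod.ι e e :=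
    congrArg (toPoly D ≫ ·) (Bicomod.whiskerL_ι_assoc e D (e.X ◁ Bicomod.ι e e)).symm
  have h₂ : toPoly D ≫ Bicomod.ι e e ≫ D.hom ▷ e.X ≫ Bicomod.ι e e ▷ e.X ≫ (α_ _ _ _).hom =
      toPoly D ≫ Bicomod.Hom.hom (Bicomod.whiskerR D e) ≫
        Bicomod.ι (Bicomod.comp e e) e ≫ Bicomod.ι e e ▷ e.X ≫ (α_ _ _ _).hom :=
    congrArg (toPoly D ≫ ·) (Bicomod.whiskerR_ι_assoc D e _).symm
  have h₃ := congrArg (· ≫ Bicomod.ι e (Bicomod.comp e e) ≫ e.X ◁ Bicomod.ι e e) h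
  simp only [Category.assoc] at h₃
  rw [Bicomod.associator_hom_ι] at h₃
  simp only [carrierComul, MonoidalCategory.whiskerLeft_comp,
    MonoidalCategory.comp_whiskerRight, Category.assoc]
  exact h₁.trans (h₃.trans h₂.symm)

/-- The carrier comonoid of a comonad: a comonad on `d` in the bicategory of polynomial comonoids
is in particular a comonoid in polynomials. -/
noncomputable def carrierComon : Comon PFunctor.{u, u} where
  X := carrier e
  comon :=
    { counit := carrierCounit e
      comul := carrierComul e
      counit_comul := by
        have h := congrArg (· ≫ ε[d.comon.X] ▷ carrier e) (counit_left e)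
        simp only [Category.assoc] at h
        simp only [carrierComul, carrierCounit, MonoidalCategory.comp_whiskerRight,
          Category.assoc]
        exact h.trans (Bicomod.left_counit _)
      comul_counit := by
        have h := congrArg (· ≫ carrier e ◁ ε[d.comon.X]) (counit_right e)
        simp only [Category.assoc] at h
        simp only [carrierComul, carrierCounit, MonoidalCategory.whiskerLeft_comp,
          Category.assoc]
        exact h.trans (Bicomod.right_counit _)
      comul_assoc := comul_comul e }

/-- The comonoid homomorphism (cofunctor) to `d` from the carrier comonoid of a comonad on `d`,
given by the counit of the comonad. -/
noncomputable def carrierToBase : carrierComon e ⟶ d.comon where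
  hom := toPoly (Bicategory.Comonad.counit (t := e))
  isComonHom_hom :=
    { hom_counit := rfl
      hom_comul := by
        have h := (Bicategory.Comonad.counit (t := e)).left
        have h₂ := congrArg (· ≫ d.comon.X ◁ toPoly (Bicategory.Comonad.counit (t := e)))
          (counit_left e)
        simp only [Category.assoc] at h₂
        refine Eq.trans h.symm (h₂.symm.trans ?_)
        exact congrArg (fun k => carrierComul e ≫ k) (MonoidalCategory.tensorHom_def
          (toPoly (Bicategory.Comonad.counit (t := e)))
          (toPoly (Bicategory.Comonad.counit (t := e)))).symm }

end CarrierComonoid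

end CatSharp

/-! ## Arity copresheaves -/

namespace CatSharp

open CategoryTheory MonoidalCategory PFunctor ComonObj

/-- The empty category, as a polynomial comonoid: the polynomial with no positions. For a
category `c`, the `(c, 0)`-bicomodules are the copresheaves on `c`. -/
def zero : CatSharp.{u} where
  comon :=
    { X := ⟨PEmpty, fun x => x.elim⟩
      comon :=
        { counit := Lens.mk (fun x => x.elim) (fun x => x.elim)
          comul := Lens.mk (fun x => x.elim) (fun x => x.elim)
          counit_comul := Lens.ext_atPos fun x => x.elim
          comul_counit := Lens.ext_atPos fun x => x.elim
          comul_assoc := Lens.ext_atPos fun x => x.elim } }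

section Arity

variable {c d : CatSharp.{u}} (p : d ⟶ c)

/-- The right coaction of a bicomodule, as a morphism of polynomials. -/
abbrev rightCoact : carrier p ⟶ carrier p ⊗ c.comon.X :=
  Bicomod.coactRight (c := d.comon) (d := c.comon) p

/-- The left coaction of a bicomodule, as a morphism of polynomials. -/
abbrev leftCoact : carrier p ⟶ d.comon.X ⊗ carrier p :=
  Bicomod.coactLeft (c := d.comon) (d := c.comon) p

theorem rightCoact_counit_atPos (I : (carrier p).A) :
    (⟨⟨((rightCoact p).onPos I).1, fun _ => PUnit.unit⟩,
      fun z => (rightCoact p).onDir I ⟨z.1, Lens.onDir ε[c.comon.X] _ z.2⟩⟩ :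
        (carrier p ⊗ 𝟙_ PFunctor.{u, u} : PFunctor.{u, u}).Obj ((carrier p).B I)) =
      ⟨⟨I, fun _ => PUnit.unit⟩, fun z => z.1⟩ :=
  Lens.atPos_congr (Bicomod.right_counit (c := d.comon) (d := c.comon) p) I

theorem rightCoact_fst (I : (carrier p).A) : ((rightCoact p).onPos I).1 = I :=
  congrArg (fun x => x.1.1) (rightCoact_counit_atPos p I)

/-- The object of `c` labelling a direction of `p` at the position `I`. -/
def label (I : (carrier p).A) (i : (carrier p).B I) : c.comon.X.A :=
  ((rightCoact p).onPos I).2 (cast (congrArg _ (rightCoact_fst p I).symm) i)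

/-- The action of the morphisms of `c` on the directions of `p` at the position `I`. -/
def act (I : (carrier p).A) (i : (carrier p).B I) (f : c.comon.X.B (label p I i)) :
    (carrier p).B I :=
  (rightCoact p).onDir I ⟨cast (congrArg _ (rightCoact_fst p I).symm) i, f⟩

theorem rightCoact_atPos (I : (carrier p).A) :
    (rightCoact p).atPos I = ⟨⟨I, label p I⟩, fun z => act p I z.1 z.2⟩ := by
  have aux : ∀ (x : (carrier p ⊗ c.comon.X : PFunctor.{u, u}).Obj ((carrier p).B I))
      (h : x.1.1 = I),
      x = ⟨⟨I, fun i => x.1.2 (cast (congrArg _ h.symm) i)⟩,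
        fun z => x.2 ⟨cast (congrArg _ h.symm) z.1, z.2⟩⟩ := by
    rintro ⟨⟨I', P⟩, D⟩ h
    obtain rfl : I' = I := h
    rfl
  exact aux _ (rightCoact_fst p I)

theorem act_id (I : (carrier p).A) (i : (carrier p).B I) :
    act p I i (Lens.onDir ε[c.comon.X] (label p I i) PUnit.unit) = i := by
  let F : (carrier p ⊗ c.comon.X : PFunctor.{u, u}).Obj ((carrier p).B I) →
      (carrier p ⊗ 𝟙_ PFunctor.{u, u} : PFunctor.{u, u}).Obj ((carrier p).B I) :=
    fun x => ⟨⟨x.1.1, fun _ => PUnit.unit⟩,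
      fun z => x.2 ⟨z.1, Lens.onDir ε[c.comon.X] _ z.2⟩⟩
  have h := (congrArg F (rightCoact_atPos p I)).symm.trans (rightCoact_counit_atPos p I)
  exact congrFun (eq_of_heq (Sigma.mk.inj h).2) ⟨i, PUnit.unit⟩

theorem act_comp (I : (carrier p).A) (i : (carrier p).B I) :
    (⟨Lens.onPos Δ[c.comon.X] (label p I i),
      fun z => act p I i (Lens.onDir Δ[c.comon.X] (label p I i) z)⟩ :
        (c.comon.X ⊗ c.comon.X : PFunctor.{u, u}).Obj ((carrier p).B I)) =
      ⟨⟨label p I i, fun f => label p I (act p I i f)⟩,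
        fun z => act p I (act p I i z.1) z.2⟩ := by
  let T := (carrier p ⊗ (c.comon.X ⊗ c.comon.X) : PFunctor.{u, u}).Obj ((carrier p).B I)
  let F : (carrier p ⊗ c.comon.X : PFunctor.{u, u}).Obj ((carrier p).B I) → T :=
    fun x => ⟨⟨x.1.1, fun j => Lens.onPos Δ[c.comon.X] (x.1.2 j)⟩,
      fun z => x.2 ⟨z.1, Lens.onDir Δ[c.comon.X] (x.1.2 z.1) z.2⟩⟩
  let G : (carrier p ⊗ c.comon.X : PFunctor.{u, u}).Obj ((carrier p).B I) → T :=
    fun x =>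
      let G' : (carrier p ⊗ c.comon.X : PFunctor.{u, u}).Obj ((carrier p).B x.1.1) → T :=
        fun y => ⟨⟨y.1.1, fun j => ⟨y.1.2 j, fun f => x.1.2 (y.2 ⟨j, f⟩)⟩⟩,
          fun z => x.2 ⟨y.2 ⟨z.1, z.2.1⟩, z.2.2⟩⟩
      G' ((rightCoact p).atPos x.1.1)
  have h : F ((rightCoact p).atPos I) = G ((rightCoact p).atPos I) :=
    Lens.atPos_congr (Bicomod.right_comul (c := d.comon) (d := c.comon) p) I
  rw [rightCoact_atPos] at h
  simp only [F, G] at h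
  rw [rightCoact_atPos] at h
  have aux : ∀ {I : (carrier p).A} {S : Type u}
      {P P' : (carrier p).B I → (c.comon.X ⊗ c.comon.X : PFunctor.{u, u}).A}
      {D : (Σ i, (c.comon.X ⊗ c.comon.X : PFunctor.{u, u}).B (P i)) → S}
      {D' : (Σ i, (c.comon.X ⊗ c.comon.X : PFunctor.{u, u}).B (P' i)) → S},
      (⟨⟨I, P⟩, D⟩ : (carrier p ⊗ (c.comon.X ⊗ c.comon.X) : PFunctor.{u, u}).Obj S) =
        ⟨⟨I, P'⟩, D'⟩ → ∀ i,
      (⟨P i, fun z => D ⟨i, z⟩⟩ : (c.comon.X ⊗ c.comon.X : PFunctor.{u, u}).Obj S) =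
        ⟨P' i, fun z => D' ⟨i, z⟩⟩ := by
    intro I S P P' D D' h i
    have h₁ : P = P' := eq_of_heq (Sigma.mk.inj (Sigma.mk.inj h).1).2
    subst h₁
    have h₂ : D = D' := eq_of_heq (Sigma.mk.inj h).2
    subst h₂
    rfl
  exact aux h i

theorem ext_of_isEmpty {q r : PFunctor.{u, u}} {f g : q ⟶ r} (hr : ∀ J, IsEmpty (r.B J))
    (h : ∀ I, Lens.onPos f I = Lens.onPos g I) : f = g :=
  Lens.ext_atPos fun I => Sigma.ext (h I)
    (Function.hfunext (congrArg r.B (h I)) fun z => (hr _).elim z)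

/-- The arity copresheaf `p[I]` of a `(d, c)`-bicomodule `p` at a position `I`, as a
`(c, 0)`-bicomodule: the positions are the directions of `p` at `I`, and the left coaction is the
restriction of the right coaction of `p` to the directions at `I`. -/
def arity (I : (carrier p).A) : c ⟶ zero.{u} :=
  Bicomod.mk (c := c.comon) (d := zero.comon)
    (X := ⟨(carrier p).B I, fun _ => PEmpty⟩)
    (coactLeft := Lens.mk (fun i => ⟨label p I i, fun f => act p I i f⟩) (fun _ z => z.2))
    (coactRight := Lens.mk (fun i => ⟨i, fun x => x.elim⟩) (fun _ z => z.1))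
    (left_counit := ext_of_isEmpty (fun _ => ⟨fun z => z.2.elim⟩) fun i =>
      Sigma.ext rfl (heq_of_eq (funext fun _ => act_id p I i)))
    (left_comul := ext_of_isEmpty (fun _ => ⟨fun z => z.2.elim⟩) fun i => act_comp p I i)
    (right_counit := ext_of_isEmpty (fun _ => ⟨fun z => z.1.elim⟩) fun _ =>
      Sigma.ext rfl (heq_of_eq (funext fun x => x.elim)))
    (right_comul := ext_of_isEmpty (fun _ => ⟨fun z => z.1.elim⟩) fun _ =>
      Sigma.ext rfl (heq_of_eq (funext fun x => x.elim)))
    (middle := ext_of_isEmpty (fun _ => ⟨fun z => z.1.2.elim⟩) fun _ =>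
      Sigma.ext rfl (heq_of_eq (funext fun x => x.2.elim)))

end Arity

/-- The set `p_D(1)` of positions of `p` lying over the object `D` of `d`. -/
def fiber {c d : CatSharp.{u}} (p : d ⟶ c) (D : d.comon.X.A) : Set (carrier p).A :=
  {I | ((leftCoact p).onPos I).1 = D}

/-- The full subcategory of the Kleisli category of a monad `m` on `c`, acting on copresheaves on
`c`, spanned by the arity copresheaves `p[I]` for positions `I` of `p`. -/
abbrev ArityKleisli {c d : CatSharp.{u}} (m : c ⟶ c) [MonObj m] (p : d ⟶ c) : Type u :=
  InducedCategory (Kleisli (BicategoryKan.homMonad m zero.{u}))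
    (fun I : (carrier p).A => Kleisli.mk _ (arity p I))

section Coclosure

open Bicategory

variable {c d : CatSharp.{u}} {m : c ⟶ c} [MonObj m] {p : d ⟶ c} {t : LeftLift (p ≫ m) p}

/-- The carrier comonoid of the comonad on `d` given by the coclosure of `p` by `p ≫ m`, the
universal `L` with a morphism `p ⟶ L ≫ (p ≫ m)`. -/
noncomputable def kanCarrier (H : t.IsKan) : Comon PFunctor.{u, u} :=
  letI := BicategoryKan.kanComonad H
  carrierComon t.lift

/-- The cofunctor to `d` from the carrier comonoid of the coclosure of `p` by `p ≫ m`. -/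
noncomputable def kanCarrierToBase (H : t.IsKan) : kanCarrier H ⟶ d.comon :=
  letI := BicategoryKan.kanComonad H
  carrierToBase t.lift

/-- The position of the coclosure `L` of `p` by `p ≫ m` corresponding to a position `I` of `p`, as
given by the universal morphism `p ⟶ L ≫ (p ≫ m)`. -/
noncomputable def kanPos (H : t.IsKan) (I : (carrier p).A) : (kanCarrier H).X.A :=
  (Lens.onPos (toPoly t.unit ≫ incl t.lift (p ≫ m)) I).1

end Coclosure

end CatSharp

open CategoryTheory CategoryTheory.Bicategory

/-! A lens `p → x ◁ q` assigns to each position `I` of `p` a position of `x` and, to each direction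
of `x` there, a lens `y^{p[I]} → q`. The representable `y^{p[I]}` inherits a right coaction from
`p`, and right colinearity can be tested on these lenses one at a time (`rightColinear_iff`). So a
universal right colinear map out of `p` can be written down: its target has one position for each
`I`, and its directions at `I` are the right colinear lenses `y^{p[I]} → q`. The universal property
transports the two remaining coactions to this target, which makes it universal among bicomodules as
well (`RightCoclosure.bicomod`, `coclosureIsKan`).

Now take `q = p ◁_c m`. A lens `y^{p[I]} → p ◁ m` is a position `J` with a function `p[J] →
m(p[I])`. It factors through the equalizer `p ◁_c m` exactly when the function respects the left
coactions of `c`, and it is right colinear exactly when the values of the function lie in the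
equalizer `m ◁_c p[I]`. The two conditions together describe a copresheaf map `p[J] → m ◁_c p[I]`,
that is, a Kleisli morphism from `p[J]` to `p[I]` (`eltOfHom_injective`, `eltOfHom_surjective`).
Hence the carrier polynomial of the opposite of the arity Kleisli category is itself a coclosure
(`kleisliCoclosure`).

Counit and comultiplication of the comonad are determined by what they do after the universal map.
There the counit picks out the Kleisli identities (`kleisliUnit_counit`) and the comultiplication is
Kleisli composition (`kleisliUnit_comul`), so for this model the isomorphism of comonoids is the
identity on carriers. Any other coclosure is compared with it by the universal property. The
comparison respects the comonad structures (`desc_kanCounit`, `desc_kanComul`) and the universal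
maps, so it also carries the named positions to each other. The statement over `d` holds because the
counit after `η` is the unit `p → p ◁_c m`, which preserves left coactions. -/

/-! ## Right coclosures of bicomodules -/

namespace Bicomod

open MonoidalCategory Limits ComonObj

universe v w

variable {V : Type w} [Category.{v} V] [MonoidalCategory V] {b c d : Comon V}

/-- A morphism `p ⟶ x ⊗ q` is right colinear if it commutes with the right coactions of `p` and
`q`. -/
def RightColinear (p : Bicomod b c) (q : Bicomod d c) {x : V} (k : p.X ⟶ x ⊗ q.X) : Prop :=
  p.coactRight ≫ k ▷ c.X ≫ (α_ x q.X c.X).hom = k ≫ x ◁ q.coactRight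

/-- An object with a universal right colinear morphism `p ⟶ E ⊗ q`. -/
structure RightCoclosure (p : Bicomod b c) (q : Bicomod d c) where
  /-- The carrier. -/
  E : V
  /-- The universal morphism. -/
  η : p.X ⟶ E ⊗ q.X
  colinear : RightColinear p q η
  /-- The morphism induced by a right colinear morphism. -/
  desc : ∀ {x : V} (k : p.X ⟶ x ⊗ q.X), RightColinear p q k → (E ⟶ x)
  fac : ∀ {x : V} (k : p.X ⟶ x ⊗ q.X) (hk : RightColinear p q k), η ≫ desc k hk ▷ q.X = k
  hom_ext : ∀ {x : V} {f g : E ⟶ x}, η ≫ f ▷ q.X = η ≫ g ▷ q.X → f = g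

namespace RightCoclosure

variable {p : Bicomod b c} {q : Bicomod d c} (t : RightCoclosure p q)

/-- The left and right coactions of `p` commute, so coacting on the left before applying `t.η` does
not disturb right colinearity. This licenses the definition of the left coaction by the universal
property. -/
theorem colinear_left :
    RightColinear p q (p.coactLeft ≫ b.X ◁ t.η ≫ (α_ b.X t.E q.X).inv) := by
  have h := t.colinear
  have h' := congrArg (b.X ◁ ·) h
  simp only [MonoidalCategory.whiskerLeft_comp] at h'
  simp only [RightColinear, MonoidalCategory.comp_whiskerRight, Category.assoc] at h ⊢
  rw [reassoc_of% p.middle, ← MonoidalCategory.associator_inv_naturality_right, ← reassoc_of% h']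
  congr 1
  simp

/-- Here the compatibility used is that of the two coactions of `q`. The left coaction of `q`
becomes the right coaction of the coclosure. -/
theorem colinear_right :
    RightColinear p q (t.η ≫ t.E ◁ q.coactLeft ≫ (α_ t.E d.X q.X).inv) := by
  have h := t.colinear
  have h' := q.middle_whiskerLeft t.E
  simp only [RightColinear, MonoidalCategory.comp_whiskerRight, Category.assoc] at h ⊢
  -- Inserting an associator and its inverse creates the left side of `h`, which can then be
  -- rewritten.
  have e : t.η ▷ c.X = t.η ▷ c.X ≫ (α_ t.E q.X c.X).hom ≫ (α_ t.E q.X c.X).inv := by simp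
  rw [e]
  simp only [Category.assoc]
  rw [reassoc_of% h, ← MonoidalCategory.associator_inv_naturality_right]
  rw [← MonoidalCategory.associator_inv_naturality_middle_assoc, reassoc_of% h']
  congr 1
  simp

/-- The left coaction on a right coclosure. -/
def coactLeft : t.E ⟶ b.X ⊗ t.E := t.desc _ t.colinear_left

/-- The right coaction on a right coclosure. -/
def coactRight : t.E ⟶ t.E ⊗ d.X := t.desc _ t.colinear_right

theorem η_coactLeft : t.η ≫ t.coactLeft ▷ q.X =
    p.coactLeft ≫ b.X ◁ t.η ≫ (α_ b.X t.E q.X).inv := t.fac _ _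

theorem η_coactRight : t.η ≫ t.coactRight ▷ q.X =
    t.η ≫ t.E ◁ q.coactLeft ≫ (α_ t.E d.X q.X).inv := t.fac _ _

/-- The bicomodule structure on a right coclosure. -/
@[simps]
abbrev bicomod : Bicomod b d where
  X := t.E
  coactLeft := t.coactLeft
  coactRight := t.coactRight
  -- Every axiom is checked after `t.η`. The left axioms reduce to those of the left coaction of
  -- `p`, the right axioms to those of the left coaction of `q`, and the middle one to the
  -- interchange law, the two coactions being applied on different sides of `t.η`.
  left_counit := t.hom_ext (by
    rw [MonoidalCategory.comp_whiskerRight, reassoc_of% t.η_coactLeft,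
      ← MonoidalCategory.associator_inv_naturality_left, MonoidalCategory.whisker_exchange_assoc,
      reassoc_of% p.left_counit]
    simp)
  left_comul := t.hom_ext (by
    simp only [MonoidalCategory.comp_whiskerRight]
    rw [reassoc_of% t.η_coactLeft, reassoc_of% t.η_coactLeft,
      ← MonoidalCategory.associator_inv_naturality_left, MonoidalCategory.whisker_exchange_assoc,
      reassoc_of% p.left_comul,
      ← MonoidalCategory.associator_inv_naturality_middle_assoc,
      ← MonoidalCategory.whiskerLeft_comp_assoc,
      t.η_coactLeft]
    simp)
  right_counit := t.hom_ext (by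
    simp only [MonoidalCategory.comp_whiskerRight]
    rw [reassoc_of% t.η_coactRight, ← MonoidalCategory.associator_inv_naturality_middle,
      ← MonoidalCategory.whiskerLeft_comp_assoc, q.left_counit]
    simp)
  right_comul := t.hom_ext (by
    simp only [MonoidalCategory.comp_whiskerRight]
    rw [reassoc_of% t.η_coactRight, reassoc_of% t.η_coactRight,
      ← MonoidalCategory.associator_inv_naturality_middle,
      ← MonoidalCategory.whiskerLeft_comp_assoc, q.left_comul,
      ← MonoidalCategory.associator_inv_naturality_left_assoc,
      MonoidalCategory.whisker_exchange_assoc,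
      reassoc_of% t.η_coactRight]
    simp)
  middle := t.hom_ext (by
    simp only [MonoidalCategory.comp_whiskerRight]
    rw [reassoc_of% t.η_coactRight, reassoc_of% t.η_coactLeft,
      ← MonoidalCategory.associator_inv_naturality_left, MonoidalCategory.whisker_exchange_assoc,
      reassoc_of% t.η_coactLeft, ← MonoidalCategory.associator_inv_naturality_middle_assoc,
      ← MonoidalCategory.whiskerLeft_comp_assoc, t.η_coactRight]
    simp)

variable [HasEqualizers V]
variable [∀ X : V, PreservesLimitsOfShape WalkingParallelPair (tensorLeft X)]
variable [∀ X : V, PreservesLimitsOfShape WalkingParallelPair (tensorRight X)]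

/-- The universal morphism of a right coclosure, as a morphism of bicomodules. -/
noncomputable def unit : p ⟶ comp t.bicomod q :=
  liftHom t.bicomod q t.η t.η_coactRight (by
    change _ = t.η ≫ t.coactLeft ▷ q.X ≫ (α_ b.X t.E q.X).hom
    rw [reassoc_of% t.η_coactLeft]; simp) (by
    have h := t.colinear
    rw [RightColinear] at h
    change _ = t.η ≫ t.E ◁ q.coactRight ≫ (α_ t.E q.X c.X).inv
    rw [← reassoc_of% h]
    simp)

@[simp]
theorem unit_ι : (t.unit).hom ≫ ι t.bicomod q = t.η := liftHom_ι _ _ _ _ _ _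

/-- The right coaction on a composite is that of its second factor, so a bicomodule map into the
composite becomes right colinear once the equalizer is included in the tensor product. -/
theorem colinear_of_hom {r : Bicomod b d} (k : p ⟶ comp r q) :
    RightColinear p q (k.hom ≫ ι r q) := by
  rw [RightColinear, MonoidalCategory.comp_whiskerRight_assoc, reassoc_of% k.right,
    comp_right_ι_assoc]
  simp

/-- The morphism of bicomodules out of a right coclosure given by its universal property. -/
noncomputable def descHom {r : Bicomod b d} (k : p ⟶ comp r q) : t.bicomod ⟶ r where
  hom := t.desc _ (colinear_of_hom k)
  left := t.hom_ext (by
    simp only [MonoidalCategory.comp_whiskerRight, bicomod_X]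
    rw [reassoc_of% t.η_coactLeft, ← MonoidalCategory.associator_inv_naturality_middle,
      ← MonoidalCategory.whiskerLeft_comp_assoc, t.fac,
      reassoc_of% (t.fac _ (colinear_of_hom k)), MonoidalCategory.whiskerLeft_comp_assoc,
      reassoc_of% k.left, comp_left_ι_assoc]
    simp)
  right := t.hom_ext (by
    simp only [MonoidalCategory.comp_whiskerRight, bicomod_X]
    rw [reassoc_of% t.η_coactRight, ← MonoidalCategory.associator_inv_naturality_left,
      MonoidalCategory.whisker_exchange_assoc, reassoc_of% (t.fac _ (colinear_of_hom k)),
      reassoc_of% (t.fac _ (colinear_of_hom k)),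
      ι_condition])

theorem unit_descHom {r : Bicomod b d} (k : p ⟶ comp r q) :
    t.unit ≫ whiskerR (t.descHom k) q = k := by
  refine hom_ext_ι ?_
  rw [comp_hom, Category.assoc, whiskerR_ι, reassoc_of% t.unit_ι]
  exact t.fac _ _

theorem bicomod_hom_ext {r : Bicomod b d} {f g : t.bicomod ⟶ r}
    (h : t.unit ≫ whiskerR f q = t.unit ≫ whiskerR g q) : f = g := by
  refine Bicomod.hom_ext (t.hom_ext ?_)
  have h' := congrArg (fun k => Hom.hom k ≫ ι r q) h
  simpa only [comp_hom, Category.assoc, whiskerR_ι, reassoc_of% t.unit_ι] using h'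

end RightCoclosure

end Bicomod

/-! ### Coclosures of carriers as left Kan lifts. -/

namespace CatSharp

variable {b c d : CatSharp.{u}} {p : b ⟶ c} {q : d ⟶ c}

/-- The left Kan lift of `p` along `q` given by a right coclosure of carriers. -/
noncomputable def coclosureLift
    (t : Bicomod.RightCoclosure (b := b.comon) (c := c.comon) (d := d.comon) p q) :
    LeftLift q p :=
  LeftLift.mk (f := q) (g := p) t.bicomod t.unit

/-- The left lift given by a right coclosure of carriers is a left Kan lift. -/
noncomputable def coclosureIsKan
    (t : Bicomod.RightCoclosure (b := b.comon) (c := c.comon) (d := d.comon) p q) :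
    (coclosureLift t).IsKan :=
  LeftLift.IsKan.mk (fun s => LeftLift.homMk (t.descHom s.unit) (t.unit_descHom s.unit))
    (fun s τ => StructuredArrow.hom_ext _ _ (t.bicomod_hom_ext
      ((LeftLift.w τ).trans (t.unit_descHom s.unit).symm)))

end CatSharp

/-! ### Lenses from representable and constant polynomials into composites. -/

namespace PFunctor

open MonoidalCategory

variable {p q r x y : PFunctor.{u, u}} {S T : Type u}

/-- An element of a composite polynomial functor, as an element of an iterated one. -/
def splitObj (z : (p ⊗ q : PFunctor.{u, u}).Obj S) : p.Obj (q.Obj S) :=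
  ⟨z.1.1, fun i => ⟨z.1.2 i, fun j => z.2 ⟨i, j⟩⟩⟩

/-- Serves to compare elements of composites: once regrouped, two elements with the same outer
position differ only by a family, so their equality becomes a pointwise one. -/
theorem splitObj_injective :
    Function.Injective (splitObj : (p ⊗ q : PFunctor.{u, u}).Obj S → p.Obj (q.Obj S)) :=
  Function.LeftInverse.injective
    (g := fun z => ⟨⟨z.1, fun i => (z.2 i).1⟩, fun k => (z.2 k.1).2 k.2⟩) fun _ => rfl

/-- A morphism out of a representable polynomial is determined by its component at the unique
position. -/
theorem rep_hom_ext_iff {f g : rep S ⟶ p} :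
    f = g ↔ Lens.atPos f PUnit.unit = Lens.atPos g PUnit.unit :=
  ⟨fun h => Lens.atPos_congr h _, fun h => Lens.ext_atPos fun _ => h⟩

theorem mk_eq_mk_iff {A : Type*} {B : A → Type*} {a : A} {b b' : B a} :
    (⟨a, b⟩ : Sigma B) = ⟨a, b'⟩ ↔ b = b' :=
  ⟨fun h => eq_of_heq (Sigma.mk.inj h).2, fun h => h ▸ rfl⟩

/-- Acting on the first factor only reindexes the family of lenses. A universal family is therefore
one in which every admissible lens occurs exactly once. -/
theorem compEquiv_whiskerRight (k : r ⟶ x ⊗ p) (f : x ⟶ y) (I : r.A) :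
    compEquiv y p (k ≫ f ▷ p) I =
      ⟨Lens.onPos f (compEquiv x p k I).1,
        fun i => (compEquiv x p k I).2 (Lens.onDir f (compEquiv x p k I).1 i)⟩ :=
  rfl

/-- The morphism from a representable polynomial to a composite given by a position of the first
factor and a family of elements of the second. -/
def repComp (J : p.A) (G : p.B J → q.Obj S) : rep S ⟶ p ⊗ q :=
  Lens.mk (fun _ => ⟨J, fun j => (G j).1⟩) (fun _ z => (G z.1).2 z.2)

theorem exists_repComp (k : rep S ⟶ p ⊗ q) : ∃ J G, k = repComp J G :=
  ⟨(Lens.onPos k PUnit.unit).1,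
    fun j => ⟨(Lens.onPos k PUnit.unit).2 j, fun z => Lens.onDir k PUnit.unit ⟨j, z⟩⟩, rfl⟩

theorem repComp_injective {z z' : Σ J : p.A, p.B J → q.Obj S}
    (h : repComp z.1 z.2 = repComp z'.1 z'.2) : z = z' :=
  congrArg splitObj (Lens.atPos_congr h PUnit.unit)

/-- The constant polynomial. -/
abbrev const (S : Type u) : PFunctor.{u, u} := ⟨S, fun _ => PEmpty⟩

/-- The morphism from a constant polynomial to a composite given by a family of elements. -/
def constComp (G : T → q.Obj S) : const T ⟶ q ⊗ const S :=
  Lens.mk G (fun _ z => z.2.elim)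

theorem const_hom_ext {k k' : const T ⟶ q ⊗ const S}
    (h : ∀ i, Lens.onPos k i = Lens.onPos k' i) : k = k' :=
  CatSharp.ext_of_isEmpty (fun _ => ⟨fun z => z.2.elim⟩) h

end PFunctor

namespace CatSharp

open MonoidalCategory PFunctor ComonObj

/-! ### Composite bicomodules inside composites of their carriers. -/

section Incl

variable {a b c d : CatSharp.{u}}

theorem incl_condition (p : a ⟶ b) (q : b ⟶ c) :
    incl p q ≫ rightCoact p ▷ carrier q =
      incl p q ≫ carrier p ◁ leftCoact q ≫ (α_ (carrier p) b.comon.X (carrier q)).inv :=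
  Bicomod.ι_condition (c := a.comon) (d := b.comon) (e := c.comon) p q

theorem leftCoact_incl (p : a ⟶ b) (q : b ⟶ c) :
    leftCoact (p ≫ q) ≫ a.comon.X ◁ incl p q =
      incl p q ≫ leftCoact p ▷ carrier q ≫ (α_ a.comon.X (carrier p) (carrier q)).hom :=
  Bicomod.compLeft_ι (c := a.comon) (d := b.comon) (e := c.comon) p q

theorem rightCoact_incl (p : a ⟶ b) (q : b ⟶ c) :
    rightCoact (p ≫ q) ≫ incl p q ▷ c.comon.X =
      incl p q ≫ carrier p ◁ rightCoact q ≫ (α_ (carrier p) (carrier q) c.comon.X).inv :=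
  Bicomod.compRight_ι (c := a.comon) (d := b.comon) (e := c.comon) p q

theorem leftCoact_toPoly {p q : a ⟶ b} (f : p ⟶ q) :
    leftCoact p ≫ a.comon.X ◁ toPoly f = toPoly f ≫ leftCoact q :=
  Bicomod.Hom.left f

theorem toPoly_comp {p q r : a ⟶ b} (f : p ⟶ q) (g : q ⟶ r) :
    toPoly (f ≫ g) = toPoly f ≫ toPoly g := rfl

theorem whiskerLeft_incl (p : a ⟶ b) {q q' : b ⟶ c} (f : q ⟶ q') :
    toPoly (p ◁ f) ≫ incl p q' = incl p q ≫ carrier p ◁ toPoly f :=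
  Bicomod.whiskerL_ι (c := a.comon) (d := b.comon) (e := c.comon) p f

theorem whiskerRight_incl {p p' : a ⟶ b} (f : p ⟶ p') (q : b ⟶ c) :
    toPoly (f ▷ q) ≫ incl p' q = incl p q ≫ toPoly f ▷ carrier q :=
  Bicomod.whiskerR_ι (c := a.comon) (d := b.comon) (e := c.comon) f q

theorem leftUnitor_inv_incl (p : a ⟶ b) :
    toPoly (Bicategory.leftUnitor p).inv ≫ incl (𝟙 a) p = leftCoact p :=
  Bicomod.leftUnitorInv_ι (c := a.comon) (d := b.comon) p

theorem rightUnitor_inv_incl (p : a ⟶ b) :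
    toPoly (Bicategory.rightUnitor p).inv ≫ incl p (𝟙 b) = rightCoact p :=
  Bicomod.rightUnitorInv_ι (c := a.comon) (d := b.comon) p

theorem associator_hom_incl (p : a ⟶ b) (q : b ⟶ c) (r : c ⟶ d) :
    toPoly (Bicategory.associator p q r).hom ≫ incl p (q ≫ r) ≫ carrier p ◁ incl q r =
      incl (p ≫ q) r ≫ incl p q ▷ carrier r ≫ (α_ (carrier p) (carrier q) (carrier r)).hom :=
  Bicomod.associator_hom_ι (b := a.comon) (c := b.comon) (d := c.comon) (e := d.comon) p q r

theorem associator_inv_incl (p : a ⟶ b) (q : b ⟶ c) (r : c ⟶ d) :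
    toPoly (Bicategory.associator p q r).inv ≫ incl (p ≫ q) r ≫ incl p q ▷ carrier r =
      incl p (q ≫ r) ≫ carrier p ◁ incl q r ≫ (α_ (carrier p) (carrier q) (carrier r)).inv :=
  Bicomod.associator_inv_ι (b := a.comon) (c := b.comon) (d := c.comon) (e := d.comon) p q r

/-- The morphism of polynomials into a composite bicomodule induced by an equalizing morphism. -/
noncomputable def liftIncl (p : a ⟶ b) (q : b ⟶ c) {x : PFunctor.{u, u}}
    (k : x ⟶ carrier p ⊗ carrier q)
    (h : k ≫ rightCoact p ▷ carrier q =
      k ≫ carrier p ◁ leftCoact q ≫ (α_ (carrier p) b.comon.X (carrier q)).inv) :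
    x ⟶ carrier (p ≫ q) :=
  Bicomod.lift (c := a.comon) (d := b.comon) (e := c.comon) p q k h

theorem liftIncl_incl (p : a ⟶ b) (q : b ⟶ c) {x : PFunctor.{u, u}}
    (k : x ⟶ carrier p ⊗ carrier q)
    (h : k ≫ rightCoact p ▷ carrier q =
      k ≫ carrier p ◁ leftCoact q ≫ (α_ (carrier p) b.comon.X (carrier q)).inv) :
    liftIncl p q k h ≫ incl p q = k :=
  Bicomod.lift_ι (c := a.comon) (d := b.comon) (e := c.comon) p q k h

end Incl

/-! ### Right colinearity, one position at a time. -/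

section Colinear

variable {b c d : CatSharp.{u}} (p : b ⟶ c) (q : d ⟶ c)

/-- The right coaction on the representable polynomial with directions `p[I]`. -/
def repCoact (I : (carrier p).A) : rep ((carrier p).B I) ⟶ rep ((carrier p).B I) ⊗ c.comon.X :=
  Lens.mk (fun _ => ⟨PUnit.unit, label p I⟩) (fun _ z => act p I z.1 z.2)

/-- The morphisms of right comodules from the representable polynomial with directions `p[I]`. -/
@[ext]
structure Elt (I : (carrier p).A) : Type u where
  /-- The underlying morphism of polynomials. -/
  hom : rep ((carrier p).B I) ⟶ carrier q
  colinear : hom ≫ rightCoact q = repCoact p I ≫ hom ▷ c.comon.X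

variable {p q}

/-- Right colinearity, pointwise. -/
theorem rightColinear_iff {x : PFunctor.{u, u}} (k : carrier p ⟶ x ⊗ carrier q) :
    Bicomod.RightColinear (b := b.comon) (c := c.comon) (d := d.comon) p q k ↔
      ∀ I i, (compEquiv x (carrier q) k I).2 i ≫ rightCoact q =
        repCoact p I ≫ (compEquiv x (carrier q) k I).2 i ▷ c.comon.X := by
  rw [Bicomod.RightColinear, ← (compEquiv x (carrier q ⊗ c.comon.X)).injective.eq_iff,
    funext_iff]
  refine forall_congr' fun I => ?_
  -- The right coaction fixes the position `I` only up to a propositional equality. Writing the left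
  -- side as a function `F` of the value of the coaction at `I` lets `rightCoact_atPos` replace that
  -- value by its normal form without transports. The same device recurs below.
  let F : (carrier p ⊗ c.comon.X : PFunctor.{u, u}).Obj ((carrier p).B I) →
      Σ i : x.A, x.B i → (rep ((carrier p).B I) ⟶ carrier q ⊗ c.comon.X) :=
    fun z => ⟨(Lens.onPos k z.1.1).1, fun i => Lens.mk
      (fun _ => ⟨(Lens.onPos k z.1.1).2 i, fun j => z.1.2 (Lens.onDir k z.1.1 ⟨i, j⟩)⟩)
      (fun _ j => z.2 ⟨Lens.onDir k z.1.1 ⟨i, j.1⟩, j.2⟩)⟩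
  have h := congrArg F (rightCoact_atPos p I)
  have h₁ : compEquiv x (carrier q ⊗ c.comon.X)
      (rightCoact p ≫ k ▷ c.comon.X ≫ (α_ x (carrier q) c.comon.X).hom) I =
        ⟨(compEquiv x (carrier q) k I).1, fun i =>
          repCoact p I ≫ (compEquiv x (carrier q) k I).2 i ▷ c.comon.X⟩ := h
  have h₂ := compEquiv_naturality x _ k (rightCoact q) I
  refine (Eq.congr h₁ h₂).trans ((mk_eq_mk_iff.trans funext_iff).trans ?_)
  exact forall_congr' fun i => eq_comm

end Colinear

/-! ### Colinear elements of `p ◁_c m` as maps of arity copresheaves. -/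

section Coclosure

variable {b c d e : CatSharp.{u}} (p : d ⟶ c) (m : c ⟶ e) (r : b ⟶ e) (I : (carrier r).A)

variable {p m}

/-- The equalizer condition for `p ◁_c m`, unfolded at each direction of `p` at `J`, is
compatibility of the family `G` with the coactions of `c`. This is left colinearity of `G` viewed as
a function out of the copresheaf `p[J]`. -/
theorem repComp_equalizes_iff {S : Type u} (J : (carrier p).A)
    (G : (carrier p).B J → (carrier m).Obj S) :
    repComp J G ≫ rightCoact p ▷ carrier m =
        repComp J G ≫ carrier p ◁ leftCoact m ≫ (α_ (carrier p) c.comon.X (carrier m)).inv ↔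
      ∀ j, (⟨label p J j, fun a => G (act p J j a)⟩ : c.comon.X.Obj ((carrier m).Obj S)) =
        splitObj ⟨Lens.onPos (leftCoact m) (G j).1,
          fun z => (G j).2 (Lens.onDir (leftCoact m) (G j).1 z)⟩ := by
  let F : (carrier p ⊗ c.comon.X : PFunctor.{u, u}).Obj ((carrier p).B J) →
      (carrier p).Obj (c.comon.X.Obj ((carrier m).Obj S)) :=
    fun y => ⟨y.1.1, fun i => ⟨y.1.2 i, fun a => G (y.2 ⟨i, a⟩)⟩⟩
  have h := congrArg F (rightCoact_atPos p J)
  rw [rep_hom_ext_iff, ← splitObj_injective.eq_iff, ← splitObj_injective.eq_iff]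
  refine (Eq.congr h rfl).trans ((mk_eq_mk_iff.trans funext_iff))

/-- Dually to the previous lemma, colinearity over `e` does not constrain how the values of `G` vary
with `j`: it says that each value satisfies the equalizer condition of `m ◁_e r[I]`. -/
theorem repComp_colinear_iff (J : (carrier p).A)
    (G : (carrier p).B J → (carrier m).Obj ((carrier r).B I)) :
    repComp J G ≫ carrier p ◁ rightCoact m ≫ (α_ (carrier p) (carrier m) e.comon.X).inv =
        repCoact r I ≫ repComp J G ▷ e.comon.X ↔
      ∀ j, splitObj ⟨Lens.onPos (rightCoact m) (G j).1,
          fun z => (G j).2 (Lens.onDir (rightCoact m) (G j).1 z)⟩ =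
        (⟨(G j).1, fun i => ⟨label r I ((G j).2 i), fun a => act r I ((G j).2 i) a⟩⟩ :
          (carrier m).Obj (e.comon.X.Obj ((carrier r).B I))) := by
  rw [rep_hom_ext_iff, ← splitObj_injective.eq_iff, ← splitObj_injective.eq_iff]
  exact (Eq.congr rfl rfl).trans (mk_eq_mk_iff.trans funext_iff)

/-- The elements of `m` evaluated at `r[I]` underlying a morphism `p[J] ⟶ m ≫ r[I]`. -/
noncomputable def eltsOfHom {J : (carrier p).A} (f : arity p J ⟶ m ≫ arity r I) :
    (carrier p).B J → (carrier m).Obj ((carrier r).B I) :=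
  Lens.onPos (toPoly f ≫ incl m (arity r I))

variable {r I}

theorem constComp_eltsOfHom {J : (carrier p).A} (f : arity p J ⟶ m ≫ arity r I) :
    constComp (eltsOfHom r I f) = toPoly f ≫ incl m (arity r I) :=
  const_hom_ext fun _ => rfl

/-- A copresheaf has no directions, so a map between copresheaves is determined by its positions,
and these may be compared after the monic inclusion of the equalizer. -/
theorem eltsOfHom_injective {J : (carrier p).A} :
    Function.Injective (eltsOfHom (p := p) (m := m) (J := J) r I) := fun f g h =>
  Bicomod.hom_ext_ι (c := c.comon) (d := e.comon) (e := zero.comon)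
    ((constComp_eltsOfHom f).symm.trans ((congrArg constComp h).trans (constComp_eltsOfHom g)))

/-- Left colinearity of `f`, in the form that `repComp_equalizes_iff` asks for. -/
theorem eltsOfHom_left {J : (carrier p).A} (f : arity p J ⟶ m ≫ arity r I) (j) :
    (⟨label p J j, fun a => eltsOfHom r I f (act p J j a)⟩ :
        c.comon.X.Obj ((carrier m).Obj ((carrier r).B I))) =
      splitObj ⟨Lens.onPos (leftCoact m) (eltsOfHom r I f j).1,
        fun z => (eltsOfHom r I f j).2
          (Lens.onDir (leftCoact m) (eltsOfHom r I f j).1 z)⟩ := by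
  have h : leftCoact (arity p J) ≫ c.comon.X ◁ (toPoly f ≫ incl m (arity r I)) =
      (toPoly f ≫ incl m (arity r I)) ≫ leftCoact m ▷ carrier (arity r I) ≫
        (α_ c.comon.X (carrier m) (carrier (arity r I))).hom := by
    rw [MonoidalCategory.whiskerLeft_comp, reassoc_of% leftCoact_toPoly f, leftCoact_incl,
      Category.assoc]
  exact congrArg Sigma.fst (Lens.atPos_congr h j)

/-- The values of `f` lie in an equalizer; this is the form that `repComp_colinear_iff` asks for. -/
theorem eltsOfHom_right {J : (carrier p).A} (f : arity p J ⟶ m ≫ arity r I) (j) :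
    splitObj ⟨Lens.onPos (rightCoact m) (eltsOfHom r I f j).1,
          fun z => (eltsOfHom r I f j).2 (Lens.onDir (rightCoact m) (eltsOfHom r I f j).1 z)⟩ =
        (⟨(eltsOfHom r I f j).1, fun i => ⟨label r I ((eltsOfHom r I f j).2 i),
            fun a => act r I ((eltsOfHom r I f j).2 i) a⟩⟩ :
          (carrier m).Obj (e.comon.X.Obj ((carrier r).B I))) := by
  have h : (toPoly f ≫ incl m (arity r I)) ≫ rightCoact m ▷ carrier (arity r I) ≫
        (α_ (carrier m) e.comon.X (carrier (arity r I))).hom =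
      (toPoly f ≫ incl m (arity r I)) ≫ carrier m ◁ leftCoact (arity r I) := by
    rw [Category.assoc, reassoc_of% incl_condition m (arity r I)]
    simp
  exact congrArg Sigma.fst (Lens.atPos_congr h j)

/-- A morphism `p[J] ⟶ m ≫ r[I]` from its underlying elements. -/
theorem exists_eltsOfHom {J : (carrier p).A}
    (G : (carrier p).B J → (carrier m).Obj ((carrier r).B I))
    (h₁ : ∀ j, (⟨label p J j, fun a => G (act p J j a)⟩ :
        c.comon.X.Obj ((carrier m).Obj ((carrier r).B I))) =
      splitObj ⟨Lens.onPos (leftCoact m) (G j).1,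
          fun z => (G j).2 (Lens.onDir (leftCoact m) (G j).1 z)⟩)
    (h₂ : ∀ j, splitObj ⟨Lens.onPos (rightCoact m) (G j).1,
          fun z => (G j).2 (Lens.onDir (rightCoact m) (G j).1 z)⟩ =
        (⟨(G j).1, fun i => ⟨label r I ((G j).2 i), fun a => act r I ((G j).2 i) a⟩⟩ :
          (carrier m).Obj (e.comon.X.Obj ((carrier r).B I)))) :
    ∃ f : arity p J ⟶ m ≫ arity r I, eltsOfHom r I f = G := by
  refine ⟨Bicomod.liftHom (c := c.comon) (d := e.comon) (e := zero.comon) (r := arity p J)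
    m (arity r I) (constComp G) ?_ ?_ ?_, ?_⟩
  -- The equalizer condition is `h₂` regrouped, left colinearity is `h₁`, and colinearity over the
  -- empty category holds because copresheaves have no directions.
  · exact ext_of_isEmpty (fun _ => ⟨fun z => z.2.elim⟩) fun j =>
      congrArg (fun z : (carrier m).Obj (e.comon.X.Obj ((carrier r).B I)) =>
        (⟨⟨z.1, fun i => (z.2 i).1⟩, fun k => (z.2 k.1).2 k.2⟩ :
          (carrier m ⊗ e.comon.X : PFunctor.{u, u}).Obj ((carrier r).B I))) (h₂ j)
  · exact ext_of_isEmpty (fun _ => ⟨fun z => z.2.2.elim⟩) h₁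
  · exact ext_of_isEmpty (fun _ => ⟨fun z => z.1.2.elim⟩) fun j =>
      Sigma.ext rfl (heq_of_eq (funext fun x => x.2.elim))
  · exact congrArg Lens.onPos (Bicomod.liftHom_ι (c := c.comon) (d := e.comon) (e := zero.comon)
      (r := arity p J) m (arity r I) (constComp G) _ _ _)

/-- The morphism of right comodules from the representable polynomial with directions `r[I]` to
`p ≫ m` corresponding to a morphism `p[J] ⟶ m ≫ r[I]`. -/
noncomputable def eltOfHom {J : (carrier p).A} (f : arity p J ⟶ m ≫ arity r I) :
    Elt r (p ≫ m) I :=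
  ⟨liftIncl p m (repComp J (eltsOfHom r I f))
    ((repComp_equalizes_iff J _).2 (eltsOfHom_left f)), by
    -- Tensoring on the right preserves the equalizer, so colinearity may be tested in `p ◁ m ◁ e`.
    refine (cancel_mono (incl p m ▷ e.comon.X)).1 ?_
    rw [Category.assoc, Category.assoc, ← MonoidalCategory.comp_whiskerRight, liftIncl_incl,
      rightCoact_incl, reassoc_of% liftIncl_incl]
    exact (repComp_colinear_iff r I J _).2 (eltsOfHom_right f)⟩

theorem eltOfHom_incl {J : (carrier p).A} (f : arity p J ⟶ m ≫ arity r I) :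
    (eltOfHom f).hom ≫ incl p m = repComp J (eltsOfHom r I f) :=
  liftIncl_incl p m _ ((repComp_equalizes_iff J _).2 (eltsOfHom_left f))

/-- The lens remembers its position `J` as well as the function on `p[J]`, so injectivity holds on
the whole sum over `J`. -/
theorem eltOfHom_injective :
    Function.Injective fun f : Σ J, (arity p J ⟶ m ≫ arity r I) => eltOfHom f.2 := by
  rintro ⟨J, f⟩ ⟨J', f'⟩ h
  have h₁ := congrArg (fun z => Elt.hom z ≫ incl p m) h
  simp only [eltOfHom_incl] at h₁
  have h₂ := repComp_injective (z := ⟨J, eltsOfHom r I f⟩) (z' := ⟨J', eltsOfHom r I f'⟩) h₁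
  obtain rfl : J = J' := congrArg Sigma.fst h₂
  rw [eltsOfHom_injective (mk_eq_mk_iff.1 h₂)]

/-- A colinear lens, included in `p ◁ m`, is some `repComp J G`. Its factorization through the
equalizer and its colinearity are the two conditions from which `exists_eltsOfHom` builds a
copresheaf map. -/
theorem eltOfHom_surjective :
    Function.Surjective fun f : Σ J, (arity p J ⟶ m ≫ arity r I) => eltOfHom f.2 := by
  rintro ⟨u, hu⟩
  obtain ⟨J, G, h⟩ := exists_repComp (u ≫ incl p m)
  obtain ⟨f, hf⟩ := exists_eltsOfHom (r := r) (I := I) G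
    ((repComp_equalizes_iff J G).1 (by rw [← h, Category.assoc, Category.assoc, incl_condition]))
    ((repComp_colinear_iff r I J G).1 (by
      rw [← h, MonoidalCategory.comp_whiskerRight, ← reassoc_of% hu, rightCoact_incl,
        Category.assoc]))
  refine ⟨⟨J, f⟩, Elt.ext ((cancel_mono (incl p m)).1 ?_)⟩
  rw [eltOfHom_incl, hf, h]

end Coclosure

end CatSharp

namespace CatSharp

open MonoidalCategory PFunctor ComonObj

/-! ### Kleisli composites on underlying elements. -/

section Whisker

variable {c d : CatSharp.{u}} {m : c ⟶ c} {p : d ⟶ c}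

theorem eltsOfHom_comp_whiskerRight {n : c ⟶ c} {I J : (carrier p).A}
    (f : arity p J ⟶ n ≫ arity p I) (φ : n ⟶ m) (j : (carrier p).B J) :
    eltsOfHom p I (f ≫ φ ▷ arity p I) j = ⟨Lens.onPos (toPoly φ) (eltsOfHom p I f j).1,
      fun z => (eltsOfHom p I f j).2 (Lens.onDir (toPoly φ) (eltsOfHom p I f j).1 z)⟩ := by
  have h : toPoly (f ≫ φ ▷ arity p I) ≫ incl m (arity p I) =
      (toPoly f ≫ incl n (arity p I)) ≫ toPoly φ ▷ carrier (arity p I) := by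
    rw [toPoly_comp, Category.assoc, whiskerRight_incl, Category.assoc]
  exact congrArg (fun k => Lens.onPos k j) h

/-- This is the Kleisli composite before multiplication: substitute the elements of `f` into those
of `g`. The carrier of `m ≫ m` is an equalizer without a usable description of its positions, so the
formula can be stated only after inclusion in `m ◁ m`. -/
theorem eltsOfHom_comp_whiskerLeft {I J K : (carrier p).A}
    (g : arity p K ⟶ m ≫ arity p J) (f : arity p J ⟶ m ≫ arity p I) (k : (carrier p).B K) :
    let H := eltsOfHom p I (g ≫ m ◁ f ≫ (Bicategory.associator m m (arity p I)).inv) k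
    splitObj ⟨Lens.onPos (incl m m) H.1, fun z => H.2 (Lens.onDir (incl m m) H.1 z)⟩ =
      ⟨(eltsOfHom p J g k).1, fun n => eltsOfHom p I f ((eltsOfHom p J g k).2 n)⟩ := by
  have h : (toPoly (g ≫ m ◁ f ≫ (Bicategory.associator m m (arity p I)).inv) ≫
      incl (m ≫ m) (arity p I)) ≫ incl m m ▷ carrier (arity p I) ≫
        (MonoidalCategory.associator (carrier m) (carrier m) (carrier (arity p I))).hom =
      (toPoly g ≫ incl m (arity p J)) ≫
        carrier m ◁ (toPoly f ≫ incl m (arity p I)) := by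
    have h₁ := reassoc_of% associator_inv_incl m m (arity p I)
    simp only [toPoly_comp, Category.assoc]
    rw [h₁, reassoc_of% whiskerLeft_incl]
    simp
  exact congrArg (fun l => Lens.onPos l k) h

end Whisker

/-! ### The arity Kleisli polynomial as a coclosure. -/

section KleisliCoclosure

variable {c d : CatSharp.{u}} (m : c ⟶ c) [MonObj m] (p : d ⟶ c)

/-- The carrier of the comonoid corresponding to the opposite of the arity Kleisli category. -/
noncomputable abbrev kleisliPoly : PFunctor.{u, u} := (ofCategory (ArityKleisli m p)ᵒᵖ).X

/-- The 2-cell underlying a direction of the arity Kleisli polynomial. -/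
noncomputable def kleisliHom {I : (carrier p).A} (f : (kleisliPoly m p).B (Opposite.op I)) :
    arity p f.1.unop ⟶ m ≫ arity p I :=
  f.2.unop.hom.of

/-- The directions of the arity Kleisli polynomial, as morphisms of right comodules. -/
noncomputable def kleisliElt (I : (carrier p).A) (f : (kleisliPoly m p).B (Opposite.op I)) :
    Elt p (p ≫ m) I :=
  eltOfHom (kleisliHom m p f)

theorem kleisliElt_bijective (I : (carrier p).A) : Function.Bijective (kleisliElt m p I) := by
  -- A morphism out of `p[I]` in the opposite category is a Kleisli morphism into `p[I]`; the
  -- equivalence only removes the wrappers.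
  let e : (kleisliPoly m p).B (Opposite.op I) ≃ Σ J, (arity p J ⟶ m ≫ arity p I) :=
    { toFun f := ⟨f.1.unop, kleisliHom m p f⟩
      invFun f := ⟨Opposite.op f.1, Quiver.Hom.op ⟨⟨f.2⟩⟩⟩ }
  exact Function.Bijective.comp
    (g := fun f : Σ J, (arity p J ⟶ m ≫ arity p I) => eltOfHom f.2)
    ⟨eltOfHom_injective, eltOfHom_surjective⟩ e.bijective

/-- The universal morphism into the composite of the arity Kleisli polynomial with `p ≫ m`. -/
noncomputable def kleisliUnit : carrier p ⟶ kleisliPoly m p ⊗ carrier (p ≫ m) :=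
  (compEquiv _ _).symm fun I => ⟨Opposite.op I, fun f => (kleisliElt m p I f).hom⟩

/-- The arity Kleisli polynomial is a right coclosure of `p` by `p ≫ m`. -/
noncomputable def kleisliCoclosure :
    Bicomod.RightCoclosure (b := d.comon) (c := c.comon) (d := d.comon) p (p ≫ m) where
  E := kleisliPoly m p
  η := kleisliUnit m p
  colinear := (rightColinear_iff _).2 fun I f => (kleisliElt m p I f).colinear
  -- On directions the map is forced: the lens that `k` attaches to `i` is right colinear, so it is
  -- named by exactly one Kleisli morphism.
  desc {x} k hk := Lens.mk (fun I => (compEquiv x _ k I.unop).1) (fun I i =>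
    (Equiv.ofBijective _ (kleisliElt_bijective m p I.unop)).symm
      ⟨(compEquiv x _ k I.unop).2 i, (rightColinear_iff k).1 hk I.unop i⟩)
  fac {x} k hk := (compEquiv x _).injective <| funext fun I => by
    rw [compEquiv_whiskerRight]
    refine mk_eq_mk_iff.2 (funext fun i => ?_)
    exact congrArg Elt.hom ((Equiv.ofBijective _ (kleisliElt_bijective m p I)).apply_symm_apply
      ⟨(compEquiv x _ k I).2 i, (rightColinear_iff k).1 hk I i⟩)
  hom_ext {x f g} h := by
    obtain ⟨f₁, f₂⟩ := f
    obtain ⟨g₁, g₂⟩ := g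
    have h' := fun I => congrFun (congrArg (compEquiv x _) h) I
    simp only [compEquiv_whiskerRight] at h'
    obtain rfl : f₁ = g₁ := funext fun I => congrArg Sigma.fst (h' I.unop)
    have h₂ : f₂ = g₂ := funext fun I => funext fun i =>
      (kleisliElt_bijective m p I.unop).1 (Elt.ext
        (congrFun (mk_eq_mk_iff.1 (h' I.unop)) i))
    subst h₂
    rfl

/-- The coclosure of `p` by `p ≫ m` given by the arity Kleisli category. -/
noncomputable abbrev kleisliLift : LeftLift (p ≫ m) p := coclosureLift (kleisliCoclosure m p)

theorem kleisliLift_unit_incl :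
    toPoly (kleisliLift m p).unit ≫ incl (kleisliLift m p).lift (p ≫ m) = kleisliUnit m p :=
  (kleisliCoclosure m p).unit_ι

/-! ### The counit: Kleisli identities. -/

theorem eltsOfHom_id (I : (carrier p).A) (i : (carrier p).B I) :
    eltsOfHom p I ((Bicategory.leftUnitor (arity p I)).inv ≫ BicategoryKan.unit m ▷ arity p I) i =
      ⟨Lens.onPos (toPoly (BicategoryKan.unit m)) (label p I i), fun z =>
        act p I i (Lens.onDir (toPoly (BicategoryKan.unit m)) (label p I i) z)⟩ := by
  have h : toPoly ((Bicategory.leftUnitor (arity p I)).inv ≫ BicategoryKan.unit m ▷ arity p I) ≫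
      incl m (arity p I) = leftCoact (arity p I) ≫
        toPoly (BicategoryKan.unit m) ▷ carrier (arity p I) := by
    rw [toPoly_comp, Category.assoc, whiskerRight_incl, reassoc_of% leftUnitor_inv_incl]
  exact congrArg (fun k => Lens.onPos k i) h

theorem compUnit_incl : toPoly (BicategoryKan.compUnit m p) ≫ incl p m =
    rightCoact p ≫ carrier p ◁ toPoly (BicategoryKan.unit m) := by
  rw [BicategoryKan.compUnit, toPoly_comp, Category.assoc, whiskerLeft_incl,
    reassoc_of% rightUnitor_inv_incl]

/-- The counit of a category selects identities. In the Kleisli category these are the components of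
the unit of `m`, which on elements is what `compUnit` applies to the directions of `p`. -/
theorem kleisliUnit_counit :
    kleisliUnit m p ≫ ε[kleisliPoly m p] ▷ carrier (p ≫ m) =
      toPoly (BicategoryKan.compUnit m p) ≫
        (MonoidalCategory.leftUnitor (carrier (p ≫ m))).inv := by
  refine (compEquiv _ _).injective (funext fun I => ?_)
  refine Sigma.ext rfl (heq_of_eq (funext fun _ => ?_))
  -- The inclusion of the summand of `p` at the position `I`.
  let k : rep ((carrier p).B I) ⟶ carrier p := Lens.mk (fun _ => I) (fun _ i => i)
  change (eltOfHom ((Bicategory.leftUnitor (arity p I)).inv ≫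
    BicategoryKan.unit m ▷ arity p I)).hom = k ≫ toPoly (BicategoryKan.compUnit m p)
  refine (cancel_mono (incl p m)).1 ?_
  rw [eltOfHom_incl, Category.assoc, compUnit_incl, rep_hom_ext_iff]
  let φ := toPoly (BicategoryKan.unit m)
  let F : (carrier p ⊗ c.comon.X : PFunctor.{u, u}).Obj ((carrier p).B I) →
      (carrier p ⊗ carrier m : PFunctor.{u, u}).Obj ((carrier p).B I) :=
    fun z => ⟨⟨z.1.1, fun i => Lens.onPos φ (z.1.2 i)⟩,
      fun i => z.2 ⟨i.1, Lens.onDir φ (z.1.2 i.1) i.2⟩⟩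
  have h : Lens.atPos (k ≫ rightCoact p ≫ carrier p ◁ φ) PUnit.unit =
      F ⟨⟨I, label p I⟩, fun z => act p I z.1 z.2⟩ := congrArg F (rightCoact_atPos p I)
  rw [funext (eltsOfHom_id m p I)]
  exact h.symm

/-! ### The comultiplication: Kleisli composition. -/

variable {m p}

/-- The multiplication of `m` is defined on the equalizer `m ≫ m`, not on `m ◁ m`. The coaction is
therefore factored as an `N` landing in the equalizer followed by multiplication, and `N` is
described by its image in `m ◁ m`, where elements can be computed. -/
theorem kanAct_incl (t : LeftLift (p ≫ m) p) :
    ∃ N : carrier (p ≫ m) ⟶ carrier t.lift ⊗ (carrier p ⊗ carrier (m ≫ m)),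
      toPoly (BicategoryKan.kanAct t) ≫ incl t.lift (p ≫ m) ≫ carrier t.lift ◁ incl p m =
        N ≫ carrier t.lift ◁ carrier p ◁ toPoly (BicategoryKan.mult m) ∧
      N ≫ carrier t.lift ◁ carrier p ◁ incl m m =
        incl p m ≫ (toPoly t.unit ≫ incl t.lift (p ≫ m)) ▷ carrier m ≫
          (MonoidalCategory.associator (carrier t.lift) (carrier (p ≫ m)) (carrier m)).hom ≫
          carrier t.lift ◁ (incl p m ▷ carrier m ≫
            (MonoidalCategory.associator (carrier p) (carrier m) (carrier m)).hom) := by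
  -- `N` is `kanAct t` with the final multiplication removed.
  refine ⟨toPoly (t.unit ▷ m ≫ (Bicategory.associator t.lift (p ≫ m) m).hom) ≫
    incl t.lift ((p ≫ m) ≫ m) ≫ carrier t.lift ◁
      (toPoly (Bicategory.associator p m m).hom ≫ incl p (m ≫ m)), ?_, ?_⟩
  · rw [BicategoryKan.kanAct, BicategoryKan.compMult]
    simp only [toPoly_comp, Category.assoc]
    rw [reassoc_of% whiskerLeft_incl, ← MonoidalCategory.whiskerLeft_comp,
      ← MonoidalCategory.whiskerLeft_comp, toPoly_comp, Category.assoc, whiskerLeft_incl,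
      Category.assoc]
  · simp only [toPoly_comp, Category.assoc, ← MonoidalCategory.whiskerLeft_comp]
    rw [associator_hom_incl, MonoidalCategory.whiskerLeft_comp,
      reassoc_of% associator_hom_incl, reassoc_of% whiskerRight_incl]
    simp

variable (m p) in
/-- The coaction of the arity Kleisli polynomial on `p ≫ m`. -/
noncomputable def kleisliAct : carrier (p ≫ m) ⟶ kleisliPoly m p ⊗ carrier (p ≫ m) :=
  toPoly (BicategoryKan.kanAct (kleisliLift m p)) ≫ incl (kleisliLift m p).lift (p ≫ m)

variable (m p) in
theorem kleisliAct_incl :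
    ∃ N : carrier (p ≫ m) ⟶ kleisliPoly m p ⊗ (carrier p ⊗ carrier (m ≫ m)),
      kleisliAct m p ≫ kleisliPoly m p ◁ incl p m =
        N ≫ kleisliPoly m p ◁ carrier p ◁ toPoly (BicategoryKan.mult m) ∧
      N ≫ kleisliPoly m p ◁ carrier p ◁ incl m m =
        incl p m ≫ kleisliUnit m p ▷ carrier m ≫
          (MonoidalCategory.associator (kleisliPoly m p) (carrier (p ≫ m)) (carrier m)).hom ≫
          kleisliPoly m p ◁ (incl p m ▷ carrier m ≫
            (MonoidalCategory.associator (carrier p) (carrier m) (carrier m)).hom) := by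
  obtain ⟨N, hN₁, hN₂⟩ := kanAct_incl (kleisliLift m p)
  rw [kleisliLift_unit_incl] at hN₂
  exact ⟨N, (Category.assoc _ _ _).trans hN₁, hN₂⟩

/-- The pairs of composable morphisms of the arity Kleisli category ending at `p[I]`, as elements
of `p ≫ (m ≫ m)`. -/
noncomputable def kleisliPair (I : (carrier p).A) (f : (kleisliPoly m p).B (Opposite.op I)) :
    rep ((carrier p).B I) ⟶ kleisliPoly m p ⊗ (carrier p ⊗ carrier (m ≫ m)) :=
  (compEquiv (kleisliPoly m p) _).symm fun _ => ⟨f.1, fun g => repComp g.1.unop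
    (eltsOfHom p I (kleisliHom m p g ≫ m ◁ kleisliHom m p f ≫
      (Bicategory.associator m m (arity p I)).inv))⟩

/-- Multiplying the pairs gives composition in the Kleisli category; this is the only place where
the Kleisli composition law is unfolded. -/
theorem kleisliPair_mult (I : (carrier p).A) (f : (kleisliPoly m p).B (Opposite.op I)) :
    kleisliPair I f ≫ kleisliPoly m p ◁ carrier p ◁ toPoly (BicategoryKan.mult m) =
      (compEquiv (kleisliPoly m p) (carrier (p ≫ m))).symm (fun _ =>
        ⟨f.1, fun g => (kleisliElt m p I ⟨g.1, f.2 ≫ g.2⟩).hom⟩) ≫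
          kleisliPoly m p ◁ incl p m := by
  refine (compEquiv (kleisliPoly m p) _).injective (funext fun _ => ?_)
  refine Sigma.ext rfl (heq_of_eq (funext fun g => ?_))
  refine Eq.trans ?_ (eltOfHom_incl (kleisliHom m p ⟨g.1, f.2 ≫ g.2⟩)).symm
  -- Passing to the opposite reverses the order: in the Kleisli category `g` is applied first, then
  -- `f` under `m`, then the multiplication.
  have h : kleisliHom m p (I := I) ⟨g.1, f.2 ≫ g.2⟩ =
      (kleisliHom m p g ≫ m ◁ kleisliHom m p f ≫
        (Bicategory.associator m m (arity p I)).inv) ≫ BicategoryKan.mult m ▷ arity p I := by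
    simp only [Category.assoc]
    rfl
  rw [h]
  exact congrArg (repComp g.1.unop) (funext fun k => (eltsOfHom_comp_whiskerRight _ _ k).symm)

/-- Starting from the element `f` of `p ◁_c m`, the universal map replaces the `p` part by all
Kleisli morphisms `g` into its position. The remaining `m` part substitutes `f` into `g`, which is
the formula of `eltsOfHom_comp_whiskerLeft`. -/
theorem kleisliPair_incl (I : (carrier p).A) (f : (kleisliPoly m p).B (Opposite.op I)) :
    kleisliPair I f ≫ kleisliPoly m p ◁ carrier p ◁ incl m m =
      (kleisliElt m p I f).hom ≫ incl p m ≫ kleisliUnit m p ▷ carrier m ≫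
        (MonoidalCategory.associator (kleisliPoly m p) (carrier (p ≫ m)) (carrier m)).hom ≫
        kleisliPoly m p ◁ (incl p m ▷ carrier m ≫
          (MonoidalCategory.associator (carrier p) (carrier m) (carrier m)).hom) := by
  have e : (kleisliElt m p I f).hom ≫ incl p m = _ := eltOfHom_incl (kleisliHom m p f)
  rw [reassoc_of% e]
  refine (compEquiv (kleisliPoly m p) _).injective (funext fun _ => ?_)
  refine Sigma.ext rfl (heq_of_eq (funext fun g => ?_))
  -- `τ` encodes the function `p[J] → m(p[I])` underlying `f`, with `J` its source position, as a
  -- lens `y^{p[I]} → y^{p[J]} ◁ m`.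
  let F := eltsOfHom p I (kleisliHom m p f)
  let τ : rep ((carrier p).B I) ⟶ rep ((carrier p).B f.1.unop) ⊗ carrier m :=
    repComp PUnit.unit F
  change _ = τ ≫ ((kleisliElt m p f.1.unop g).hom ≫ incl p m) ▷ carrier m ≫
    (MonoidalCategory.associator (carrier p) (carrier m) (carrier m)).hom
  have e' : (kleisliElt m p f.1.unop g).hom ≫ incl p m = _ := eltOfHom_incl (kleisliHom m p g)
  rw [e']
  refine rep_hom_ext_iff.2 (splitObj_injective ?_)
  refine Sigma.ext rfl (heq_of_eq (funext fun k => splitObj_injective ?_))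
  exact eltsOfHom_comp_whiskerLeft (kleisliHom m p g) (kleisliHom m p f) k

/-- The coaction sends a Kleisli morphism `f` to the family of its precomposites with all `g`. The
factor `N` agrees with `kleisliPair` because both have the same image under the monic inclusion of
`m ≫ m`. -/
theorem kleisliElt_kleisliAct (I : (carrier p).A) (f : (kleisliPoly m p).B (Opposite.op I)) :
    (kleisliElt m p I f).hom ≫ kleisliAct m p =
      (compEquiv (kleisliPoly m p) (carrier (p ≫ m))).symm fun _ =>
        ⟨f.1, fun g => (kleisliElt m p I ⟨g.1, f.2 ≫ g.2⟩).hom⟩ := by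
  obtain ⟨N, hN₁, hN₂⟩ := kleisliAct_incl m p
  have hN : (kleisliElt m p I f).hom ≫ N = kleisliPair I f := by
    refine (cancel_mono (kleisliPoly m p ◁ carrier p ◁ incl m m)).1 ?_
    rw [Category.assoc, hN₂, kleisliPair_incl]
  refine (cancel_mono (kleisliPoly m p ◁ incl p m)).1 ?_
  rw [← kleisliPair_mult, ← hN, Category.assoc, Category.assoc, hN₁]

variable (m p) in
-- At each position and each first direction `f`, both sides are families of lenses indexed by a
-- second direction `g`, and their agreement is `kleisliElt_kleisliAct`.
theorem kleisliUnit_comul :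
    kleisliUnit m p ≫ Δ[kleisliPoly m p] ▷ carrier (p ≫ m) =
      kleisliUnit m p ≫ kleisliPoly m p ◁ kleisliAct m p ≫
        (MonoidalCategory.associator (kleisliPoly m p) (kleisliPoly m p)
          (carrier (p ≫ m))).inv := by
  rw [← Category.assoc (kleisliUnit m p), Iso.eq_comp_inv, Category.assoc]
  refine (compEquiv _ _).injective (funext fun I => ?_)
  refine Sigma.ext rfl (heq_of_eq (funext fun f => ?_))
  exact (kleisliElt_kleisliAct I f).symm

/-! ### The comonad structure of the coclosure on carriers. -/

theorem kanCounit_toPoly {t : LeftLift (p ≫ m) p} (H : t.IsKan) :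
    (toPoly t.unit ≫ incl t.lift (p ≫ m)) ≫
        toPoly (BicategoryKan.kanCounit H) ▷ carrier (p ≫ m) =
      toPoly (BicategoryKan.compUnit m p) ≫ leftCoact (p ≫ m) := by
  have h := congrArg (fun k => toPoly k ≫ incl (𝟙 d) (p ≫ m)) (BicategoryKan.unit_kanCounit H)
  simp only [toPoly_comp, Category.assoc] at h
  rw [whiskerRight_incl, leftUnitor_inv_incl] at h
  rw [Category.assoc, h]

/-- The defining equation of the comultiplication, moved into composites of carriers so that it can
be compared with a comultiplication in polynomials. -/
theorem kanComul_toPoly {t : LeftLift (p ≫ m) p} (H : t.IsKan) :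
    (toPoly t.unit ≫ incl t.lift (p ≫ m)) ≫
        (toPoly (BicategoryKan.kanComul H) ≫ incl t.lift t.lift) ▷ carrier (p ≫ m) =
      (toPoly t.unit ≫ incl t.lift (p ≫ m)) ≫
        carrier t.lift ◁ (toPoly (BicategoryKan.kanAct t) ≫ incl t.lift (p ≫ m)) ≫
          (MonoidalCategory.associator (carrier t.lift) (carrier t.lift)
            (carrier (p ≫ m))).inv := by
  have h := congrArg (fun k => toPoly k ≫ incl (t.lift ≫ t.lift) (p ≫ m) ≫
    incl t.lift t.lift ▷ carrier (p ≫ m)) (BicategoryKan.unit_kanComul H)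
  simp only [toPoly_comp, Category.assoc] at h
  rw [reassoc_of% whiskerRight_incl, associator_inv_incl, reassoc_of% whiskerLeft_incl] at h
  simp only [MonoidalCategory.comp_whiskerRight, MonoidalCategory.whiskerLeft_comp,
    Category.assoc]
  exact h

variable (m p)

/-- The Kleisli coclosure is a left Kan lift. -/
noncomputable abbrev kleisliIsKan : (kleisliLift m p).IsKan :=
  coclosureIsKan (kleisliCoclosure m p)

/-- The counit of the carrier comonoid of the Kleisli coclosure. -/
theorem kleisliLift_counit :
    toPoly (BicategoryKan.kanCounit (kleisliIsKan m p)) ≫ ε[d.comon.X] =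
      ε[kleisliPoly m p] := by
  refine (kleisliCoclosure m p).hom_ext ?_
  have h := kanCounit_toPoly (kleisliIsKan m p)
  rw [kleisliLift_unit_incl] at h
  have h₁ : leftCoact (p ≫ m) ≫ ε[d.comon.X] ▷ carrier (p ≫ m) =
    (MonoidalCategory.leftUnitor (carrier (p ≫ m))).inv :=
      Bicomod.left_counit (c := d.comon) (d := c.comon) (p ≫ m)
  have h₂ := congrArg (· ≫ ε[d.comon.X] ▷ carrier (p ≫ m)) h
  simp only [Category.assoc, h₁] at h₂
  exact h₂.trans (kleisliUnit_counit m p).symm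

/-- The comultiplication of the carrier comonoid of the Kleisli coclosure. -/
theorem kleisliLift_comul :
    toPoly (BicategoryKan.kanComul (kleisliIsKan m p)) ≫
      incl (kleisliLift m p).lift (kleisliLift m p).lift = Δ[kleisliPoly m p] := by
  refine (kleisliCoclosure m p).hom_ext ?_
  have h := kanComul_toPoly (kleisliIsKan m p)
  rw [kleisliLift_unit_incl] at h
  exact h.trans (kleisliUnit_comul m p).symm

/-- The carrier comonoid of the Kleisli coclosure corresponds to the opposite of the arity Kleisli
category. -/
noncomputable def kleisliCarrierIso :
    kanCarrier (kleisliIsKan m p) ≅ ofCategory (ArityKleisli m p)ᵒᵖ :=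
  -- The carrier of this coclosure is the Kleisli polynomial by construction, so only the structure
  -- maps have to be matched.
  Comon.mkIso (Iso.refl (kleisliPoly m p))
    ((Category.id_comp _).trans (kleisliLift_counit m p).symm)
    ((Category.id_comp _).trans (kleisliLift_comul m p).symm)

end KleisliCoclosure

end CatSharp

/-! ### Independence of the choice of coclosure. -/

namespace BicategoryKan

universe w' v' u'

variable {B : Type u'} [Bicategory.{w', v'} B] {c d : B} {m : c ⟶ c} [MonObj m] {p : d ⟶ c}
variable {t t' : LeftLift (p ≫ m) p} (H : t.IsKan) (H' : t'.IsKan)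

/-- The coaction is built from the unit of the lift by operations on its right, so a comparison of
units is also a comparison of coactions. -/
theorem kanAct_desc : kanAct t ≫ H.desc t' ▷ (p ≫ m) = kanAct t' := by
  have h := congrArg (· ▷ m) (H.fac t')
  simp only [Bicategory.comp_whiskerRight] at h
  simp only [kanAct, Category.assoc]
  rw [Bicategory.whisker_exchange, ← Bicategory.associator_naturality_left_assoc, reassoc_of% h]

theorem desc_kanCounit : H.desc t' ≫ kanCounit H' = kanCounit H := by
  refine H.hom_ext ?_
  rw [Bicategory.comp_whiskerRight, reassoc_of% (H.fac t'), unit_kanCounit, unit_kanCounit]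

/-- With `desc_kanCounit`, this makes the comparison a comonad map. After the universal map both
sides become the unit of `t'` followed by its coaction, by `kanAct_desc`. -/
theorem desc_kanComul : H.desc t' ≫ kanComul H' =
    kanComul H ≫ H.desc t' ▷ t.lift ≫ t'.lift ◁ H.desc t' := by
  refine H.hom_ext ?_
  simp only [Bicategory.comp_whiskerRight]
  rw [reassoc_of% (H.fac t'), unit_kanComul, reassoc_of% (unit_kanComul H),
    ← Bicategory.associator_inv_naturality_left_assoc, Bicategory.whisker_exchange_assoc,
    ← Bicategory.associator_inv_naturality_middle, reassoc_of% (H.fac t'),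
    ← Bicategory.whiskerLeft_comp_assoc, kanAct_desc]

end BicategoryKan

namespace CatSharp

open MonoidalCategory PFunctor ComonObj

section Uniqueness

variable {c d : CatSharp.{u}} {m : c ⟶ c} [MonObj m] {p : d ⟶ c}
variable {t t' : LeftLift (p ≫ m) p} (H : t.IsKan) (H' : t'.IsKan)

/-- The carrier comonoids of two coclosures of `p` by `p ≫ m` are isomorphic. -/
noncomputable def kanCarrierIso : kanCarrier H ≅ kanCarrier H' :=
  Comon.mkIso
    { hom := toPoly (H.desc t')
      inv := toPoly (H'.desc t)
      -- Both composites fix the unit of a Kan lift, hence are identities by uniqueness.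
      hom_inv_id := congrArg toPoly (show H.desc t' ≫ H'.desc t = 𝟙 t.lift from
        H.hom_ext (by
          rw [Bicategory.comp_whiskerRight, reassoc_of% (H.fac t'), H'.fac,
            Bicategory.id_whiskerRight, Category.comp_id]))
      inv_hom_id := congrArg toPoly (show H'.desc t ≫ H.desc t' = 𝟙 t'.lift from
        H'.hom_ext (by
          rw [Bicategory.comp_whiskerRight, reassoc_of% (H'.fac t), H.fac,
            Bicategory.id_whiskerRight, Category.comp_id])) }
    (congrArg (fun k : t.lift ⟶ 𝟙 d => toPoly k ≫ ComonObj.counit (X := d.comon.X))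
      (BicategoryKan.desc_kanCounit H H'))
    (by
      have h := congrArg (fun k => toPoly k ≫ incl t'.lift t'.lift)
        (BicategoryKan.desc_kanComul H H')
      simp only [toPoly_comp, Category.assoc] at h
      rw [whiskerLeft_incl, reassoc_of% whiskerRight_incl] at h
      refine h.trans ?_
      refine Eq.trans ?_ (Category.assoc _ _ _).symm
      exact congrArg (fun k => toPoly (BicategoryKan.kanComul H) ≫ incl t.lift t.lift ≫ k)
        (MonoidalCategory.tensorHom_def (toPoly (H.desc t')) (toPoly (H.desc t'))).symm)

theorem kanCarrierIso_kanPos (I : (carrier p).A) :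
    (kanCarrierIso H H').hom.hom.onPos (kanPos H I) = kanPos H' I := by
  have h := congrArg (fun k => toPoly k ≫ incl t'.lift (p ≫ m)) (H.fac t')
  simp only [toPoly_comp, Category.assoc] at h
  rw [whiskerRight_incl] at h
  exact congrArg (fun k : carrier p ⟶ carrier t'.lift ⊗ carrier (p ≫ m) => (Lens.onPos k I).1)
    ((Category.assoc _ _ _).trans h)

/-- The counit after the universal map is the unit `p → p ≫ m` followed by the left coaction. The
unit is a bicomodule map, so the object of `d` is the one already read off from `p`. -/
theorem kanCarrierToBase_kanPos (I : (carrier p).A) :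
    (kanCarrierToBase H).hom.onPos (kanPos H I) = (Lens.onPos (leftCoact p) I).1 := by
  have h := kanCounit_toPoly H
  rw [← leftCoact_toPoly] at h
  exact congrArg (fun k : carrier p ⟶ d.comon.X ⊗ carrier (p ≫ m) => (Lens.onPos k I).1) h

end Uniqueness

end CatSharp

/-! ### Existence, and identification of every coclosure. -/

theorem mainTheorem2 (c d : CatSharp.{u}) (m : c ⟶ c) [MonObj m] (p : d ⟶ c) :
    (∃ t : LeftLift (p ≫ m) p, Nonempty t.IsKan) ∧
    ∀ (t : LeftLift (p ≫ m) p) (H : t.IsKan),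
      ∃ Φ : CatSharp.kanCarrier H ≅ CatSharp.ofCategory (CatSharp.ArityKleisli m p)ᵒᵖ,
        (∀ I : (CatSharp.carrier p).A,
          Φ.hom.hom.onPos (CatSharp.kanPos H I) = Opposite.op I) ∧
        (∀ (D : d.comon.X.A) (I : (CatSharp.carrier p).A), I ∈ CatSharp.fiber p D →
          (Φ.inv ≫ CatSharp.kanCarrierToBase H).hom.onPos (Opposite.op I) = D) := by
  refine ⟨⟨_, ⟨CatSharp.kleisliIsKan m p⟩⟩, fun t H => ?_⟩
  let Φ := CatSharp.kanCarrierIso H (CatSharp.kleisliIsKan m p) ≪≫ CatSharp.kleisliCarrierIso m p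
  have hΦ (I : (CatSharp.carrier p).A) :
      Φ.hom.hom.onPos (CatSharp.kanPos H I) = Opposite.op I := by
    have h := CatSharp.kanCarrierIso_kanPos H (CatSharp.kleisliIsKan m p) I
    refine h.trans ?_
    -- For the Kleisli model the universal map sends `I` to the position `op I` by definition.
    exact congrArg (fun k : CatSharp.carrier p ⟶ MonoidalCategory.tensorObj
      (CatSharp.kleisliPoly m p) (CatSharp.carrier (p ≫ m)) => (PFunctor.Lens.onPos k I).1)
      (CatSharp.kleisliLift_unit_incl m p)
  refine ⟨Φ, hΦ, fun D I hI => ?_⟩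
  -- The inverse is evaluated through the positions already known to map to `op I`, which reduces
  -- the claim to `kanCarrierToBase_kanPos`.
  have h : Φ.inv.hom.onPos (Opposite.op I) = CatSharp.kanPos H I := by
    rw [← hΦ]
    exact congrArg (fun k => PFunctor.Lens.onPos k (CatSharp.kanPos H I))
      (congrArg Comon.Hom.hom Φ.hom_inv_id)
  refine Eq.trans (congrArg (CatSharp.kanCarrierToBase H).hom.onPos h) ?_
  exact (CatSharp.kanCarrierToBase_kanPos H I).trans hI
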